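/- Let $(M,g)$ be a $C^1$-spacetime: a smooth (Hausdorff, second countable, $n$-dimensional) manifold $M$ with a time-orientable Lorentzian metric $g$, of signature $(-,+,\dots,+)$, whose coefficients $g_{ij}$ in charts are of class $C^1$. A geodesic on an interval $J$ is a $C^2$-curve $\gamma\colon J\to M$ that satisfies in every chart $$\ddot\gamma^k+\sum_{i,j}\Gamma^k_{ij}\,\dot\gamma^i\dot\gamma^j=0,\qquad \Gamma^k_{ij}=\tfrac12\sum_l g^{kl}\bigl(\partial_i g_{jl}+\partial_j g_{il}-\partial_l g_{ij}\bigr);$$ it is causal if $g(\dot\gamma,\dot\gamma)\le 0$ on $J$. Assume the following. (a) $(M,g)$ is causally non-branching: there are no causal geodesic $\gamma\colon[a,b]\to M$, $t_0\in(a,b)$, $\varepsilon>0$ with $a\le t_0-\varepsilon$, $t_0+\varepsilon\le b$, and geodesic $\sigma\colon(t_0-\varepsilon,t_0+\varepsilon)\to M$ such that $\gamma=\sigma$ on $(t_0-\varepsilon,t_0]$ and $\gamma((t_0,t_0+\varepsilon))\cap\sigma((t_0,t_0+\varepsilon))=\emptyset$. (b) $(M,g)$ is non-intertwining: every $q\in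 M$ has a neighborhood $U$ such that for all $\varepsilon>0$ and all causal geodesics $\gamma_1,\gamma_2\colon[0,\varepsilon]\to U$ starting at $q$ with the same initial velocity, either $\gamma_1=\gamma_2$ on $[0,\varepsilon]$ or the set $\gamma_1((0,\varepsilon])\cap\gamma_2((0,\varepsilon])$ has no accumulation point. Let $p\in M$. Then any two causal geodesics $\gamma_1,\gamma_2$, each defined on an interval containing $[0,1]$, with $\gamma_1(0)=\gamma_2(0)=p$ and $\dot\gamma_1(0)=\dot\gamma_2(0)$, agree on $[0,1]$. Hence, with $$\mathcal E_p=\{v\in T_pM : g_p(v,v)\le 0 \text{ and there is a causal geodesic } \gamma_v \text{ with } \gamma_v(0)=p,\ \dot\gamma_v(0)=v, \text{ defined on an interval containing } [0,1]\},$$ the causal exponential map $\exp_p\colon\mathcal E_p\to M$, $\exp_p(v)=\gamma_v(1)$, is well defined. Moreover, $\exp_p$ is continuous on $\mathcal E_p$ (with the topology induced from $T_pM$). -/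

import Mathlib

open Set Topology
open scoped Manifold ContDiff

noncomputable section

/-- A time-orientable Lorentzian metric of class `C¹`, of signature `(-, +, …, +)`, on a smooth
`n`-dimensional manifold `M`. A manifold together with such a metric is a `C¹`-spacetime. -/
structure C1LorentzMetric (n : ℕ) (M : Type*) [TopologicalSpace M]
    [ChartedSpace (EuclideanSpace ℝ (Fin n)) M] [IsManifold (𝓡 n) ∞ M] where
  /-- The bilinear form `g_x` on `T_x M`. -/
  val : ∀ x : M, TangentSpace (𝓡 n) x →L[ℝ] TangentSpace (𝓡 n) x →L[ℝ] ℝ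
  symm : ∀ (x : M) (v w : TangentSpace (𝓡 n) x), val x v w = val x w v
  /-- Signature `(-, +, …, +)`: there is a vector `u` with `g_x(u, u) < 0` such that `g_x` is
  positive definite on the orthogonal complement of `u`; in particular `g_x` is nondegenerate. -/
  lorentzian : ∀ x : M, ∃ u : TangentSpace (𝓡 n) x, val x u u < 0 ∧
    ∀ w : TangentSpace (𝓡 n) x, val x u w = 0 → w ≠ 0 → 0 < val x w w
  /-- The coefficients `g_ij = g(∂_i, ∂_j)` in every chart are functions of class `C¹`. -/
  contDiffOn_coeff : ∀ φ ∈ atlas (EuclideanSpace ℝ (Fin n)) M, ∀ i j : Fin n,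
    ContDiffOn ℝ 1 (fun y : EuclideanSpace ℝ (Fin n) =>
      val (φ.symm y) (mfderiv (𝓡 n) (𝓡 n) φ.symm y (EuclideanSpace.single i (1 : ℝ)))
        (mfderiv (𝓡 n) (𝓡 n) φ.symm y (EuclideanSpace.single j (1 : ℝ)))) φ.target
  /-- Time-orientability: there is a continuous timelike vector field. -/
  timeOrientable : ∃ X : ∀ x : M, TangentSpace (𝓡 n) x,
    Continuous (fun x => (⟨x, X x⟩ : TangentBundle (𝓡 n) M)) ∧ ∀ x, val x (X x) (X x) < 0

namespace C1LorentzMetric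

variable {n : ℕ} {M : Type*} [TopologicalSpace M]
  [ChartedSpace (EuclideanSpace ℝ (Fin n)) M] [IsManifold (𝓡 n) ∞ M]

/-- The coefficient `g_ij = g(∂_i, ∂_j)` in the chart `φ`, as a function of the coordinates. -/
def coeff (g : C1LorentzMetric n M) (φ : OpenPartialHomeomorph M (EuclideanSpace ℝ (Fin n)))
    (i j : Fin n) (y : EuclideanSpace ℝ (Fin n)) : ℝ :=
  g.val (φ.symm y) (mfderiv (𝓡 n) (𝓡 n) φ.symm y (EuclideanSpace.single i (1 : ℝ)))
    (mfderiv (𝓡 n) (𝓡 n) φ.symm y (EuclideanSpace.single j (1 : ℝ)))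

/-- The partial derivative `∂_l g_ij` in the chart `φ`. -/
def partialCoeff (g : C1LorentzMetric n M)
    (φ : OpenPartialHomeomorph M (EuclideanSpace ℝ (Fin n)))
    (l i j : Fin n) (y : EuclideanSpace ℝ (Fin n)) : ℝ :=
  fderiv ℝ (g.coeff φ i j) y (EuclideanSpace.single l (1 : ℝ))

/-- The Christoffel symbol
`Γ^k_ij = (1/2) ∑_l g^{kl} (∂_i g_jl + ∂_j g_il - ∂_l g_ij)` in the chart `φ`. -/
def christoffel (g : C1LorentzMetric n M)
    (φ : OpenPartialHomeomorph M (EuclideanSpace ℝ (Fin n)))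
    (k i j : Fin n) (y : EuclideanSpace ℝ (Fin n)) : ℝ :=
  (1 / 2 : ℝ) * ∑ l : Fin n, ((Matrix.of fun a b : Fin n => g.coeff φ a b y)⁻¹ k l) *
    (g.partialCoeff φ i j l y + g.partialCoeff φ j i l y - g.partialCoeff φ l i j y)

/-- `γ` restricted to the interval `J` is a geodesic: it is of class `C²` and satisfies the geodesic
equation in every chart (with one-sided derivatives at endpoints of `J` that belong to `J`). -/
def IsGeodesicOn (g : C1LorentzMetric n M) (γ : ℝ → M) (J : Set ℝ) : Prop :=
  ContMDiffOn 𝓘(ℝ, ℝ) (𝓡 n) 2 γ J ∧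
    ∀ φ ∈ atlas (EuclideanSpace ℝ (Fin n)) M, ∀ t ∈ J, γ t ∈ φ.source → ∀ k : Fin n,
      derivWithin (derivWithin (φ ∘ γ) J) J t k +
        ∑ i : Fin n, ∑ j : Fin n, g.christoffel φ k i j (φ (γ t)) *
          derivWithin (φ ∘ γ) J t i * derivWithin (φ ∘ γ) J t j = 0

end C1LorentzMetric

/-- The velocity `γ'(t) ∈ T_{γ(t)} M` of a curve `γ` defined on `J`, as a point of the tangent
bundle. -/
def curveVelocity {n : ℕ} {M : Type*} [TopologicalSpace M]
    [ChartedSpace (EuclideanSpace ℝ (Fin n)) M] (γ : ℝ → M) (J : Set ℝ) (t : ℝ) :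
    TangentBundle (𝓡 n) M :=
  ⟨γ t, mfderivWithin 𝓘(ℝ, ℝ) (𝓡 n) γ J t (1 : ℝ)⟩

namespace C1LorentzMetric

variable {n : ℕ} {M : Type*} [TopologicalSpace M]
  [ChartedSpace (EuclideanSpace ℝ (Fin n)) M] [IsManifold (𝓡 n) ∞ M]

/-- A causal geodesic on `J`: a geodesic with `g(γ', γ') ≤ 0`. -/
def IsCausalGeodesicOn (g : C1LorentzMetric n M) (γ : ℝ → M) (J : Set ℝ) : Prop :=
  g.IsGeodesicOn γ J ∧ ∀ t ∈ J,
    g.val (γ t) (curveVelocity (n := n) γ J t).2 (curveVelocity (n := n) γ J t).2 ≤ 0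

/-- The geodesic `γ : [a, b] → M` branches at `t₀ ∈ (a, b)`: some geodesic
`σ : (t₀ - ε, t₀ + ε) → M` agrees with `γ` up to time `t₀`, and after time `t₀` the images of `γ`
and `σ` are disjoint. -/
def BranchesAt (g : C1LorentzMetric n M) (a b : ℝ) (γ : ℝ → M) (t₀ : ℝ) : Prop :=
  ∃ ε > 0, a ≤ t₀ - ε ∧ t₀ + ε ≤ b ∧ ∃ σ : ℝ → M,
    g.IsGeodesicOn σ (Ioo (t₀ - ε) (t₀ + ε)) ∧ EqOn γ σ (Ioc (t₀ - ε) t₀) ∧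
    Disjoint (γ '' Ioo t₀ (t₀ + ε)) (σ '' Ioo t₀ (t₀ + ε))

/-- No causal geodesic branches. -/
def CausallyNonBranching (g : C1LorentzMetric n M) : Prop :=
  ∀ (a b : ℝ) (γ : ℝ → M), g.IsCausalGeodesicOn γ (Icc a b) →
    ∀ t₀ ∈ Ioo a b, ¬ g.BranchesAt a b γ t₀

/-- Near `p`, two causal geodesics `[0, ε] → U` starting at `p` with the same initial velocity
either coincide or their images of `(0, ε]` meet in a set without accumulation point. -/
def NonIntertwiningAt (g : C1LorentzMetric n M) (p : M) : Prop :=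
  ∃ U ∈ 𝓝 p, ∀ ε > 0, ∀ γ₁ γ₂ : ℝ → M,
    g.IsCausalGeodesicOn γ₁ (Icc 0 ε) → g.IsCausalGeodesicOn γ₂ (Icc 0 ε) →
    MapsTo γ₁ (Icc 0 ε) U → MapsTo γ₂ (Icc 0 ε) U → γ₁ 0 = p → γ₂ 0 = p →
    curveVelocity (n := n) γ₁ (Icc 0 ε) 0 = curveVelocity (n := n) γ₂ (Icc 0 ε) 0 →
    EqOn γ₁ γ₂ (Icc 0 ε) ∨
      ¬ ∃ x : M, AccPt x (Filter.principal (γ₁ '' Ioc 0 ε ∩ γ₂ '' Ioc 0 ε))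

/-- The metric is non-intertwining at every point. -/
def NonIntertwining (g : C1LorentzMetric n M) : Prop :=
  ∀ p : M, g.NonIntertwiningAt p

/-- `γ` is a causal geodesic with `γ(0) = p` and `γ'(0) = v`, defined on an interval `J` that
contains `[0, 1]`. -/
def IsCausalGeodesicFrom (g : C1LorentzMetric n M) (p : M) (v : TangentSpace (𝓡 n) p)
    (γ : ℝ → M) (J : Set ℝ) : Prop :=
  J.OrdConnected ∧ Icc 0 1 ⊆ J ∧ g.IsCausalGeodesicOn γ J ∧
    curveVelocity (n := n) γ J 0 = ⟨p, v⟩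

/-- The domain `𝓔_p ⊆ T_p M` of the causal exponential map. -/
def causalExpDomain (g : C1LorentzMetric n M) (p : M) : Set (TangentSpace (𝓡 n) p) :=
  {v | g.val p v v ≤ 0 ∧ ∃ (γ : ℝ → M) (J : Set ℝ), g.IsCausalGeodesicFrom p v γ J}

/-- The causal exponential map `exp_p(v) = γ_v(1)`, where `γ_v` is a causal geodesic with initial
data `(p, v)` defined on an interval containing `[0, 1]` (chosen, if it is not unique). -/
def causalExp (g : C1LorentzMetric n M) (p : M) (v : g.causalExpDomain p) : M :=
  v.2.2.choose 1

end C1LorentzMetric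

end

open Filter

/-! For a `C¹` metric the Christoffel symbols are only continuous. In a chart, geodesics are the
solutions of the spray equation, for which Peano's theorem gives existence but not uniqueness; the
two geometric hypotheses supply uniqueness forward in time.

Suppose two causal spray solutions start at `q` with the same velocity. If the velocity vanishes,
both are constant, because the acceleration is quadratic in the velocity. Otherwise, if they differ
on a short interval, non-intertwining says that their images do not accumulate at `q`. The first
curve leaves `q` at once, so for a short time it misses the second entirely. A backward Peano
solution glued in front of both turns this into a branching causal geodesic, which is excluded
(`exists_eqOn_of_eq_zero`). Constancy of the energy keeps the solutions causal, and real induction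
gives `eqOn_of_eq_left`.

Forward uniqueness yields continuous dependence: by Arzelà–Ascoli every subsequence of the nearby
lifts has a further subsequence converging to a spray solution, and uniqueness identifies the limit
(`exists_tendstoAt_of_le`). Induction along `[0, 1]` passes from chart to chart. Global uniqueness
is the special case of a constant sequence of geodesics.

The hypotheses speak of geodesics in every chart, so a spray solution in one chart must be a
geodesic in all. `isGeodesicOn_symm_comp` obtains this from the coordinate invariance of the
Euler–Lagrange form, avoiding the transformation law of the Christoffel symbols. -/

/-! ### Autonomous ODEs with continuous right-hand side, and induction along `[0, 1]` -/

/-- `z` solves the autonomous equation `z' = F(z)` on `s`. -/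
def IsSolutionOn {E : Type*} [NormedAddCommGroup E] [NormedSpace ℝ E] (F : E → E) (z : ℝ → E)
    (s : Set ℝ) : Prop :=
  ∀ t ∈ s, HasDerivWithinAt z (F (z t)) s t

namespace IsSolutionOn

variable {E : Type*} [NormedAddCommGroup E] [NormedSpace ℝ E] {F : E → E} {z y : ℝ → E}
  {s t : Set ℝ}

theorem mono (h : IsSolutionOn F z s) (hts : t ⊆ s) : IsSolutionOn F z t :=
  fun τ hτ => (h τ (hts hτ)).mono hts

theorem continuousOn (h : IsSolutionOn F z s) : ContinuousOn z s :=
  fun τ hτ => (h τ hτ).continuousWithinAt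

theorem congr (h : IsSolutionOn F z s) (hy : EqOn y z s) : IsSolutionOn F y s := fun τ hτ => by
  rw [hy hτ]
  exact (h τ hτ).congr (fun _ hx => hy hx) (hy hτ)

theorem comp_add_const (h : IsSolutionOn F z s) (c : ℝ) :
    IsSolutionOn F (fun τ => z (τ + c)) ((fun τ => τ + c) ⁻¹' s) := fun τ hτ => by
  have h1 : HasDerivWithinAt (fun τ : ℝ => τ + c) 1 ((fun τ => τ + c) ⁻¹' s) τ :=
    ((hasDerivAt_id τ).add_const c).hasDerivWithinAt
  simpa [Function.comp_def] using (h (τ + c) hτ).scomp τ h1 (mapsTo_preimage _ _)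

/-- Solutions on adjacent intervals that agree at the common endpoint can be glued. -/
theorem glue {a b c : ℝ} (hab : a ≤ b) (hbc : b ≤ c) (hz : IsSolutionOn F z (Icc a b))
    (hy : IsSolutionOn F y (Icc b c)) (hzy : z b = y b) :
    IsSolutionOn F (fun τ => if τ ≤ b then z τ else y τ) (Icc a c) := by
  have e1 : EqOn (fun τ => if τ ≤ b then z τ else y τ) z (Icc a b) := fun τ hτ => by
    simp [hτ.2]
  have e2 : EqOn (fun τ => if τ ≤ b then z τ else y τ) y (Icc b c) := fun τ hτ => by
    by_cases h : τ ≤ b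
    · have : τ = b := le_antisymm h hτ.1
      simp [this, hzy]
    · simp [h]
  have h1 := hz.congr e1
  have h2 := hy.congr e2
  intro τ hτ
  rw [← Icc_union_Icc_eq_Icc hab hbc]
  rcases lt_trichotomy τ b with h | h | h
  · have hm : Icc a b ∈ 𝓝[Icc a b ∪ Icc b c] τ := by
      rw [Icc_union_Icc_eq_Icc hab hbc]
      filter_upwards [mem_nhdsWithin_of_mem_nhds (Iio_mem_nhds h), self_mem_nhdsWithin] with u h1 h2
      exact ⟨h2.1, le_of_lt h1⟩
    exact (h1 τ ⟨hτ.1, h.le⟩).mono_of_mem_nhdsWithin hm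
  · subst h
    exact (h1 τ ⟨hτ.1, le_rfl⟩).union (h2 τ ⟨le_rfl, hτ.2⟩)
  · have hm : Icc b c ∈ 𝓝[Icc a b ∪ Icc b c] τ := by
      rw [Icc_union_Icc_eq_Icc hab hbc]
      filter_upwards [mem_nhdsWithin_of_mem_nhds (Ioi_mem_nhds h), self_mem_nhdsWithin] with u h1 h2
      exact ⟨le_of_lt h1, h2.2⟩
    exact (h2 τ ⟨h.le, hτ.2⟩).mono_of_mem_nhdsWithin hm

theorem norm_sub_le {a b L : ℝ} (hz : IsSolutionOn F z (Icc a b))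
    (hL : ∀ t ∈ Icc a b, ‖F (z t)‖ ≤ L) {u v : ℝ} (hu : u ∈ Icc a b) (hv : v ∈ Icc a b) :
    ‖z v - z u‖ ≤ L * |v - u| := by
  simpa using (convex_Icc a b).norm_image_sub_le_of_norm_hasDerivWithin_le (f := z)
    (f' := fun t => F (z t)) (fun t ht => hz t ht) hL hu hv

end IsSolutionOn

/-- A sequence of solutions in a compact set, of equations whose right-hand sides converge
uniformly, has a subsequence that converges pointwise to a solution of the limit equation. -/
theorem exists_subseq_tendsto_isSolutionOn {E : Type*} [NormedAddCommGroup E] [NormedSpace ℝ E]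
    [CompleteSpace E]
    {K : Set E} (hK : IsCompact K) {F : E → E} (hF : ContinuousOn F K) {Fk : ℕ → E → E} {L : ℝ}
    (hFk : TendstoUniformlyOn Fk F atTop K) (hL : ∀ k, ∀ x ∈ K, ‖Fk k x‖ ≤ L)
    {z : ℕ → ℝ → E} {a b : ℝ} (hab : a ≤ b)
    (hz : ∀ k, IsSolutionOn (Fk k) (z k) (Icc a b)) (hmem : ∀ k, ∀ t ∈ Icc a b, z k t ∈ K) :
    ∃ φ : ℕ → ℕ, StrictMono φ ∧ ∃ w : ℝ → E, (∀ t ∈ Icc a b, w t ∈ K) ∧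
      IsSolutionOn F w (Icc a b) ∧
      ∀ t ∈ Icc a b, Tendsto (fun k => z (φ k) t) atTop (𝓝 (w t)) := by
  have hcont : ∀ k, ContinuousOn (z k) (Icc a b) := fun k => (hz k).continuousOn
  let f : ℕ → BoundedContinuousFunction (Icc a b) E := fun k =>
    BoundedContinuousFunction.mkOfCompact ⟨(Icc a b).domRestrict (z k), (hcont k).domRestrict⟩
  have hfapp : ∀ k (t : Icc a b), f k t = z k t := fun k t => rfl
  -- Arzelà–Ascoli: all values lie in `K`, and `L` is a common Lipschitz constant.
  have hcomp : IsCompact (closure (range f)) := by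
    refine BoundedContinuousFunction.arzela_ascoli K hK _ ?_ ?_
    · rintro _ x ⟨k, rfl⟩
      exact hmem k x x.2
    · refine Metric.equicontinuous_of_continuity_modulus (fun t => L * t) ?_ _ ?_
      · have : Tendsto (fun t : ℝ => L * t) (𝓝 0) (𝓝 (L * 0)) :=
          tendsto_const_nhds.mul tendsto_id
        simpa using this
      · rintro x y ⟨_, k, rfl⟩
        change dist (z k x) (z k y) ≤ L * dist (x : ℝ) y
        rw [dist_eq_norm, Real.dist_eq]
        exact (hz k).norm_sub_le (fun t ht => hL k _ (hmem k t ht)) y.2 x.2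
  obtain ⟨w₀, -, φ, hφ, hlim⟩ := hcomp.tendsto_subseq (fun k => subset_closure (mem_range_self k))
  let w : ℝ → E := IccExtend hab w₀
  have hw : ∀ t (ht : t ∈ Icc a b), w t = w₀ ⟨t, ht⟩ := fun t ht => IccExtend_of_mem hab _ ht
  have hwc : Continuous w := w₀.continuous.Icc_extend'
  have hunif : TendstoUniformlyOn (fun k => z (φ k)) w atTop (Icc a b) := by
    rw [BoundedContinuousFunction.tendsto_iff_tendstoUniformly,
      Metric.tendstoUniformly_iff] at hlim
    rw [Metric.tendstoUniformlyOn_iff]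
    intro ε hε
    filter_upwards [hlim ε hε] with k hk t ht
    rw [hw t ht]
    exact hk ⟨t, ht⟩
  have hwK : ∀ t ∈ Icc a b, w t ∈ K := fun t ht =>
    hK.isClosed.mem_of_tendsto (hunif.tendsto_at ht) (Eventually.of_forall fun k => hmem _ t ht)
  refine ⟨φ, hφ, w, hwK, ?_, fun t ht => hunif.tendsto_at ht⟩
  have hFw : ContinuousOn (fun t => F (w t)) (Icc a b) := hF.comp hwc.continuousOn hwK
  -- The limit is only known to be continuous. Once it equals this integral, it is differentiable
  -- with the right derivative.
  let W : ℝ → E := fun t => w a + ∫ s in a..t, F (w s)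
  have hWd : ∀ t ∈ Icc a b, HasDerivWithinAt W (F (w t)) (Icc a b) t := by
    intro t ht
    have : Fact (t ∈ Icc a b) := ⟨ht⟩
    refine HasDerivWithinAt.const_add _ ?_
    refine intervalIntegral.integral_hasDerivWithinAt_right ?_ ?_ (hFw t ht)
    · refine (hFw.mono ?_).intervalIntegrable
      rw [uIcc_of_le ht.1]
      exact Icc_subset_Icc_right ht.2
    · exact hFw.stronglyMeasurableAtFilter_nhdsWithin measurableSet_Icc t
  have hWw : EqOn w W (Icc a b) := by
    intro t ht
    have hdiff : Tendsto (fun k => (z (φ k) t - W t) - (z (φ k) a - W a)) atTop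
        (𝓝 ((w t - W t) - (w a - W a))) :=
      ((hunif.tendsto_at ht).sub_const _).sub
        ((hunif.tendsto_at (left_mem_Icc.2 hab)).sub_const _)
    have hzero : Tendsto (fun k => (z (φ k) t - W t) - (z (φ k) a - W a)) atTop (𝓝 0) := by
      have hFu := hK.uniformContinuousOn_of_continuous hF
      rw [Metric.tendsto_nhds]
      intro ε hε
      -- Below, `z (φ k) - W` has derivative at most `2η`: one `η` for replacing `Fk` by `F`, one
      -- for replacing the solution by its limit. The `+ 1` in the denominator covers `t = a`.
      obtain ⟨η, hη, hηε⟩ : ∃ η > 0, η * (t - a) + η * (t - a) < ε := by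
        refine ⟨ε / (2 * (t - a) + 1), by have := ht.1; positivity, ?_⟩
        have h0 : 0 ≤ t - a := sub_nonneg.2 ht.1
        rw [← two_mul, div_mul_eq_mul_div, ← mul_div_assoc, div_lt_iff₀ (by positivity)]
        nlinarith
      obtain ⟨δ, hδ, hFδ⟩ := Metric.uniformContinuousOn_iff.1 hFu η hη
      have hFk' := Metric.tendstoUniformlyOn_iff.1 hFk η hη
      filter_upwards [hφ.tendsto_atTop.eventually hFk',
        Metric.tendstoUniformlyOn_iff.1 hunif δ hδ] with k hk1 hk2
      rw [dist_zero_right]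
      have hder : ∀ s ∈ Icc a b, HasDerivWithinAt (fun s => z (φ k) s - W s)
          (Fk (φ k) (z (φ k) s) - F (w s)) (Icc a b) s := fun s hs =>
        (hz (φ k) s hs).sub (hWd s hs)
      have hbd : ∀ s ∈ Icc a b, ‖Fk (φ k) (z (φ k) s) - F (w s)‖ ≤ η + η := by
        intro s hs
        rw [← dist_eq_norm]
        have h1 := hk1 _ (hmem (φ k) s hs)
        rw [dist_comm] at h1
        have h2 := hFδ _ (hmem (φ k) s hs) _ (hwK s hs) (by rw [dist_comm]; exact hk2 s hs)
        exact (dist_triangle _ _ _).trans (add_le_add h1.le h2.le)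
      have := (convex_Icc a b).norm_image_sub_le_of_norm_hasDerivWithin_le hder hbd
        (left_mem_Icc.2 hab) ht
      refine this.trans_lt ?_
      rw [Real.norm_eq_abs, abs_of_nonneg (sub_nonneg.2 ht.1)]
      linarith
    have h0 := tendsto_nhds_unique hdiff hzero
    have hWa : W a = w a := by simp [W]
    rw [hWa, sub_self, sub_zero, sub_eq_zero] at h0
    exact h0
  intro t ht
  exact (hWd t ht).congr (fun s hs => hWw hs) (hWw ht)

/-- **Peano's theorem** for autonomous equations. -/
theorem exists_isSolutionOn_of_continuousOn {E : Type*} [NormedAddCommGroup E] [NormedSpace ℝ E]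
    [FiniteDimensional ℝ E] {F : E → E} {z₀ : E} {r : ℝ} (hr : 0 < r)
    (hF : ContinuousOn F (Metric.closedBall z₀ r)) :
    ∃ δ > 0, ∃ z : ℝ → E, z 0 = z₀ ∧ IsSolutionOn F z (Icc (-δ) δ) ∧
      ∀ t ∈ Icc (-δ) δ, z t ∈ Metric.closedBall z₀ r := by
  have : ProperSpace E := FiniteDimensional.proper ℝ E
  have hK : IsCompact (Metric.closedBall z₀ r) := isCompact_closedBall z₀ r
  -- Radial retraction onto the ball: `F ∘ ρ` is continuous on all of `E` and so has global `C¹`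
  -- approximations.
  let ρ : E → E := fun x => z₀ + (r / max r ‖x - z₀‖) • (x - z₀)
  have hpos : ∀ x, 0 < max r ‖x - z₀‖ := fun x => lt_max_of_lt_left hr
  have hρc : Continuous ρ := by
    refine continuous_const.add (Continuous.smul (continuous_const.div ?_ fun x => (hpos x).ne') ?_)
    · fun_prop
    · fun_prop
  have hρm : ∀ x, ρ x ∈ Metric.closedBall z₀ r := fun x => by
    rw [mem_closedBall_iff_norm, add_sub_cancel_left, norm_smul, Real.norm_eq_abs,
      abs_of_pos (div_pos hr (hpos x)), div_mul_eq_mul_div, div_le_iff₀ (hpos x)]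
    exact mul_le_mul_of_nonneg_left (le_max_right _ _) hr.le
  have hρi : ∀ x ∈ Metric.closedBall z₀ r, ρ x = x := fun x hx => by
    rw [mem_closedBall_iff_norm] at hx
    simp [ρ, max_eq_left hx, div_self hr.ne']
  have hG : Continuous (F ∘ ρ) := hF.comp_continuous hρc hρm
  obtain ⟨L₀, hL₀⟩ := hK.exists_bound_of_continuousOn hF
  have happ : ∀ k : ℕ, ∃ g : E → E, ContDiff ℝ 1 g ∧ ∀ x, dist (g x) ((F ∘ ρ) x) < 1 / (k + 1 : ℝ) :=
    fun k => by
      obtain ⟨g, hg, hd, -⟩ := hG.exists_contDiff_approx 1 (ε := fun _ => 1 / (k + 1 : ℝ))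
        continuous_const (fun _ => by positivity)
      exact ⟨g, hg, hd⟩
  choose g hg hgd using happ
  have hL₀' : 0 ≤ L₀ := (norm_nonneg _).trans (hL₀ z₀ (Metric.mem_closedBall_self hr.le))
  let L : ℝ := L₀ + 1
  have hLpos : 0 < L := by positivity
  have hgL : ∀ k x, ‖g k x‖ ≤ L := fun k x => by
    have h1 : ‖g k x - (F ∘ ρ) x‖ ≤ 1 := by
      rw [← dist_eq_norm]
      refine (hgd k x).le.trans ?_
      rw [div_le_one (by positivity)]
      linarith [(Nat.cast_nonneg k : (0 : ℝ) ≤ k)]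
    have h2 : ‖(F ∘ ρ) x‖ ≤ L₀ := hL₀ _ (hρm x)
    have := norm_le_norm_add_norm_sub' (g k x) ((F ∘ ρ) x)
    show ‖g k x‖ ≤ L₀ + 1
    linarith
  -- At speed at most `L`, a solution cannot leave the ball of radius `r` before time `r / L`; this
  -- `δ` serves all approximations.
  let δ : ℝ := r / L
  have hδ : 0 < δ := div_pos hr hLpos
  have h0m : (0 : ℝ) ∈ Icc (-δ) δ := ⟨by linarith, hδ.le⟩
  have hsol : ∀ k, ∃ z : ℝ → E, z 0 = z₀ ∧ IsSolutionOn (g k) z (Icc (-δ) δ) := fun k => by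
    obtain ⟨C, hC⟩ := ((hg k).locallyLipschitz.locallyLipschitzOn
      (s := Metric.closedBall z₀ r)).exists_lipschitzOnWith_of_compact hK
    have hPL : IsPicardLindelof (fun _ => g k) (⟨0, h0m⟩ : Icc (-δ) δ) z₀ ⟨r, hr.le⟩ 0
        ⟨L, hLpos.le⟩ C := by
      refine IsPicardLindelof.of_time_independent (fun x _ => hgL k x) hC ?_
      change L * max (δ - 0) (0 - -δ) ≤ r - 0
      simp only [sub_zero, sub_neg_eq_add, zero_add, max_self]
      exact (mul_div_cancel₀ r hLpos.ne').le
    obtain ⟨α, hα, hα'⟩ := hPL.exists_eq_forall_mem_Icc_hasDerivWithinAt₀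
    exact ⟨α, hα, hα'⟩
  choose z hz0 hz using hsol
  have hzm : ∀ k, ∀ t ∈ Icc (-δ) δ, z k t ∈ Metric.closedBall z₀ r := fun k t ht => by
    rw [mem_closedBall_iff_norm, ← hz0 k]
    refine ((hz k).norm_sub_le (fun t _ => hgL k _) h0m ht).trans ?_
    rw [sub_zero]
    have : |t| ≤ δ := abs_le.2 ht
    calc L * |t| ≤ L * δ := mul_le_mul_of_nonneg_left this hLpos.le
      _ = r := mul_div_cancel₀ r hLpos.ne'
  have hunif : TendstoUniformlyOn g F atTop (Metric.closedBall z₀ r) := by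
    rw [Metric.tendstoUniformlyOn_iff]
    intro ε hε
    filter_upwards [tendsto_one_div_add_atTop_nhds_zero_nat.eventually (gt_mem_nhds hε)]
      with k hk x hx
    have := hgd k x
    rw [Function.comp_apply, hρi x hx, dist_comm] at this
    exact this.trans hk
  obtain ⟨φ, -, w, hwK, hws, hwl⟩ := exists_subseq_tendsto_isSolutionOn hK hF hunif
    (fun k x _ => hgL k x) (by linarith) hz hzm
  refine ⟨δ, hδ, w, ?_, hws, hwK⟩
  have := hwl 0 h0m
  simp only [hz0] at this
  exact tendsto_nhds_unique this tendsto_const_nhds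

/-- Induction along `[0, 1]` for properties that locally propagate to the right. -/
theorem forall_mem_Icc_of_locally_propagates {P : ℝ → Prop} (h0 : P 0)
    (h : ∀ t₀ ∈ Icc (0 : ℝ) 1, ∃ ρ > 0, ∀ t₁ ∈ Icc (0 : ℝ) 1, ∀ t₂ ∈ Icc (0 : ℝ) 1,
      |t₁ - t₀| < ρ → |t₂ - t₀| < ρ → t₁ ≤ t₂ → P t₁ → P t₂) :
    ∀ t ∈ Icc (0 : ℝ) 1, P t := by
  let A : Set ℝ := {t | t ∈ Icc (0 : ℝ) 1 ∧ ∀ τ ∈ Icc 0 t, P τ}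
  have hA0 : (0 : ℝ) ∈ A := ⟨by simp, fun τ hτ => by
    have : τ = 0 := le_antisymm hτ.2 hτ.1
    rwa [this]⟩
  have hbdd : BddAbove A := ⟨1, fun t ht => ht.1.2⟩
  have hsup : IsLUB A (sSup A) := isLUB_csSup ⟨0, hA0⟩ hbdd
  have hs : sSup A ∈ Icc (0 : ℝ) 1 := ⟨hsup.1 hA0, hsup.2 fun t ht => ht.1.2⟩
  obtain ⟨ρ, hρ, hprop⟩ := h _ hs
  obtain ⟨t₁, ht₁, hlt, hle⟩ := hsup.exists_between (sub_lt_self _ hρ)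
  -- A single propagation interval around the supremum reaches from a point of `A` just before it to
  -- points beyond it, so `P` need not be closed or open.
  have key : ∀ t₂ ∈ Icc (0 : ℝ) 1, t₂ < sSup A + ρ → t₂ ∈ A := by
    intro t₂ ht₂ hlt₂
    refine ⟨ht₂, fun τ hτ => ?_⟩
    rcases le_total τ t₁ with hτ1 | hτ1
    · exact ht₁.2 τ ⟨hτ.1, hτ1⟩
    · refine hprop t₁ ht₁.1 τ ⟨hτ.1, hτ.2.trans ht₂.2⟩ ?_ ?_ hτ1 (ht₁.2 t₁ ⟨ht₁.1.1, le_rfl⟩)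
      · rw [abs_lt]; constructor <;> linarith
      · rw [abs_lt]; constructor <;> linarith [hτ.2]
  have h1 : (1 : ℝ) ∈ A := by
    by_contra hne
    have hm : min 1 (sSup A + ρ / 2) ∈ A := by
      refine key _ ⟨le_min zero_le_one (by linarith [hs.1]), min_le_left _ _⟩ ?_
      exact (min_le_right _ _).trans_lt (by linarith)
    rcases le_total 1 (sSup A + ρ / 2) with h | h
    · rw [min_eq_left h] at hm; exact hne hm
    · rw [min_eq_right h] at hm
      linarith [hsup.1 hm]
  exact h1.2

/-! ### Coordinate invariance of the Euler–Lagrange form -/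

section LagrangeForm

variable {V W : Type*} [NormedAddCommGroup V] [NormedSpace ℝ V] [NormedAddCommGroup W]
  [NormedSpace ℝ W]

/-- The Euler-Lagrange form of the energy of a field `G` of bilinear forms, at the position `y`,
velocity `v` and acceleration `a`, applied to `w`. -/
noncomputable def lagrangeForm (G : V → V →L[ℝ] V →L[ℝ] ℝ) (y v a w : V) : ℝ :=
  2 * G y a w + 2 * fderiv ℝ G y v v w - fderiv ℝ G y w v v

/-- This is the product rule for a pulled-back form along the line `y + s • c`: one term
differentiates `G'`, and the other two differentiate `fderiv ℝ h` in each slot. -/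
theorem fderiv_pullback_apply {G : V → V →L[ℝ] V →L[ℝ] ℝ} {G' : W → W →L[ℝ] W →L[ℝ] ℝ}
    {h : V → W} {y : V} (hh : ContDiffAt ℝ 2 h y) (hG : DifferentiableAt ℝ G y)
    (hG' : DifferentiableAt ℝ G' (h y))
    (hpull : ∀ᶠ x in 𝓝 y, ∀ a b, G x a b = G' (h x) (fderiv ℝ h x a) (fderiv ℝ h x b))
    (c a b : V) :
    fderiv ℝ G y c a b =
      fderiv ℝ G' (h y) (fderiv ℝ h y c) (fderiv ℝ h y a) (fderiv ℝ h y b) +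
      G' (h y) (fderiv ℝ (fderiv ℝ h) y c a) (fderiv ℝ h y b) +
      G' (h y) (fderiv ℝ h y a) (fderiv ℝ (fderiv ℝ h) y c b) := by
  have h1 : HasFDerivAt h (fderiv ℝ h y) y := (hh.differentiableAt (by norm_num)).hasFDerivAt
  have h2 : HasFDerivAt (fderiv ℝ h) (fderiv ℝ (fderiv ℝ h) y) y :=
    ((hh.fderiv_right (m := 1) (by norm_num)).differentiableAt (by norm_num)).hasFDerivAt
  have hγ : HasDerivAt (fun s : ℝ => y + s • c) c 0 := by
    simpa using ((hasDerivAt_id (0 : ℝ)).smul_const c).const_add y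
  have hγ0 : y + (0 : ℝ) • c = y := by simp
  have e1 : HasDerivAt (fun s : ℝ => G (y + s • c)) (fderiv ℝ G y c) 0 := by
    refine HasFDerivAt.comp_hasDerivAt (l := G) (0 : ℝ) ?_ hγ
    rw [hγ0]; exact hG.hasFDerivAt
  have e2 : HasDerivAt (fun s : ℝ => h (y + s • c)) (fderiv ℝ h y c) 0 := by
    refine HasFDerivAt.comp_hasDerivAt (l := h) (0 : ℝ) ?_ hγ
    rw [hγ0]; exact h1
  have e3 : HasDerivAt (fun s : ℝ => fderiv ℝ h (y + s • c)) (fderiv ℝ (fderiv ℝ h) y c) 0 := by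
    refine HasFDerivAt.comp_hasDerivAt (l := fderiv ℝ h) (0 : ℝ) ?_ hγ
    rw [hγ0]; exact h2
  have e4 : HasDerivAt (fun s : ℝ => G' (h (y + s • c))) (fderiv ℝ G' (h y) (fderiv ℝ h y c)) 0 := by
    refine HasFDerivAt.comp_hasDerivAt (l := G') (0 : ℝ) ?_ e2
    rw [hγ0]; exact hG'.hasFDerivAt
  have l : HasDerivAt (fun s : ℝ => G (y + s • c) a b) (fderiv ℝ G y c a b) 0 := by
    simpa using (e1.clm_apply (hasDerivAt_const (0 : ℝ) a)).clm_apply (hasDerivAt_const (0 : ℝ) b)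
  have r := (e4.clm_apply (e3.clm_apply (hasDerivAt_const (0 : ℝ) a))).clm_apply
    (e3.clm_apply (hasDerivAt_const (0 : ℝ) b))
  have hev : (fun s : ℝ => G (y + s • c) a b) =ᶠ[𝓝 0] fun s =>
      G' (h (y + s • c)) (fderiv ℝ h (y + s • c) a) (fderiv ℝ h (y + s • c) b) := by
    have hc : Tendsto (fun s : ℝ => y + s • c) (𝓝 0) (𝓝 y) := by
      have := hγ.continuousAt.tendsto
      rwa [hγ0] at this
    filter_upwards [hc.eventually hpull] with s hs
    exact hs a b
  have := l.unique (r.congr_of_eventuallyEq hev)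
  rw [this]
  simp only [hγ0, map_zero, add_zero, add_apply]

/-- The Euler-Lagrange form does not depend on the coordinates. -/
theorem lagrangeForm_pullback {G : V → V →L[ℝ] V →L[ℝ] ℝ} {G' : W → W →L[ℝ] W →L[ℝ] ℝ}
    {h : V → W} {y : V} (hh : ContDiffAt ℝ 2 h y) (hG : DifferentiableAt ℝ G y)
    (hG' : DifferentiableAt ℝ G' (h y))
    (hpull : ∀ᶠ x in 𝓝 y, ∀ a b, G x a b = G' (h x) (fderiv ℝ h x a) (fderiv ℝ h x b))
    (hsymm : ∀ a b, G' (h y) a b = G' (h y) b a) (v a w : V) :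
    lagrangeForm G y v a w = lagrangeForm G' (h y) (fderiv ℝ h y v)
      (fderiv ℝ (fderiv ℝ h) y v v + fderiv ℝ h y a) (fderiv ℝ h y w) := by
  -- By symmetry of the second derivative and of `G'`, the terms with the second derivative in `(v,
  -- w)` cancel. The one left, in `(v, v)`, is the correction to the acceleration.
  have hD : fderiv ℝ (fderiv ℝ h) y v w = fderiv ℝ (fderiv ℝ h) y w v :=
    hh.isSymmSndFDerivAt (by simp) v w
  simp only [lagrangeForm, fderiv_pullback_apply hh hG hG' hpull, hpull.self_of_nhds, map_add,
    add_apply]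
  rw [hD, hsymm (fderiv ℝ h y v) (fderiv ℝ (fderiv ℝ h) y w v)]
  ring

end LagrangeForm

/-! ### Metric, acceleration and geodesic spray in a chart -/

namespace C1LorentzMetric

variable {n : ℕ} {M : Type*} [TopologicalSpace M]
  [ChartedSpace (EuclideanSpace ℝ (Fin n)) M] [IsManifold (𝓡 n) ∞ M]
  (g : C1LorentzMetric n M) {φ ψ : OpenPartialHomeomorph M (EuclideanSpace ℝ (Fin n))}

/-- The metric in the chart `φ`, as a field of bilinear forms. -/
noncomputable def form (φ : OpenPartialHomeomorph M (EuclideanSpace ℝ (Fin n)))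
    (y : EuclideanSpace ℝ (Fin n)) :
    EuclideanSpace ℝ (Fin n) →L[ℝ] EuclideanSpace ℝ (Fin n) →L[ℝ] ℝ :=
  ∑ i, ∑ j, g.coeff φ i j y •
    (EuclideanSpace.proj (𝕜 := ℝ) i).smulRight (EuclideanSpace.proj (𝕜 := ℝ) j)

theorem form_apply (y a b : EuclideanSpace ℝ (Fin n)) :
    g.form φ y a b = ∑ i, ∑ j, g.coeff φ i j y * a i * b j := by
  simp [form, sum_apply, mul_assoc]

theorem sum_smul_single (a : EuclideanSpace ℝ (Fin n)) :
    ∑ i, a i • EuclideanSpace.single i (1 : ℝ) = a := by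
  ext k
  simp [Finset.sum_apply, Pi.single_apply]

theorem form_eq_val (φ : OpenPartialHomeomorph M (EuclideanSpace ℝ (Fin n)))
    (y a b : EuclideanSpace ℝ (Fin n)) :
    g.form φ y a b = g.val (φ.symm y) (mfderiv (𝓡 n) (𝓡 n) φ.symm y a)
      (mfderiv (𝓡 n) (𝓡 n) φ.symm y b) := by
  let A : EuclideanSpace ℝ (Fin n) →L[ℝ] TangentSpace (𝓡 n) (φ.symm y) :=
    mfderiv (𝓡 n) (𝓡 n) φ.symm y
  have hA : ∀ c : EuclideanSpace ℝ (Fin n),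
      A c = ∑ i, c i • A (EuclideanSpace.single i (1 : ℝ)) := fun c => by
    conv_lhs => rw [← sum_smul_single c]
    simp only [map_sum, map_smul]
  have : g.val (φ.symm y) (A a) (A b) = ∑ i, ∑ j, a i * (b j * g.coeff φ i j y) := by
    rw [hA a, hA b]
    simp only [map_sum, map_smul, sum_apply, smul_apply,
      smul_eq_mul, Finset.mul_sum]
    have hc : ∀ i j, g.val (φ.symm y) (A (EuclideanSpace.single i (1 : ℝ)))
        (A (EuclideanSpace.single j (1 : ℝ))) = g.coeff φ i j y := fun i j => rfl
    simp only [hc]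
    rw [Finset.sum_comm]
    refine Finset.sum_congr rfl fun i _ => Finset.sum_congr rfl fun j _ => ?_
    ring
  refine Eq.trans ?_ this.symm
  rw [form_apply]
  refine Finset.sum_congr rfl fun i _ => Finset.sum_congr rfl fun j _ => ?_
  ring

theorem form_single (y : EuclideanSpace ℝ (Fin n)) (i j : Fin n) :
    g.form φ y (EuclideanSpace.single i 1) (EuclideanSpace.single j 1) = g.coeff φ i j y := by
  rw [form_eq_val]; rfl

theorem form_symm (y a b : EuclideanSpace ℝ (Fin n)) : g.form φ y a b = g.form φ y b a := by
  rw [form_eq_val, form_eq_val, g.symm]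

theorem mdifferentiable_of_mem_atlas (hφ : φ ∈ atlas (EuclideanSpace ℝ (Fin n)) M) :
    φ.MDifferentiable (𝓡 n) (𝓡 n) :=
  have : IsManifold (𝓡 n) 1 M := .of_le (n := ∞) (by simp)
  _root_.mdifferentiable_of_mem_atlas hφ

/-- Nondegeneracy from the signature: a nonzero vector orthogonal to everything is orthogonal to the
timelike `u`, hence has positive square, although it is orthogonal to itself. -/
theorem eq_zero_of_form_eq_zero (hφ : φ ∈ atlas (EuclideanSpace ℝ (Fin n)) M)
    {y : EuclideanSpace ℝ (Fin n)} (hy : y ∈ φ.target) {a : EuclideanSpace ℝ (Fin n)}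
    (h : ∀ b, g.form φ y a b = 0) : a = 0 := by
  have hb := (mdifferentiable_of_mem_atlas hφ).symm.mfderiv_bijective (x := y) hy
  refine hb.1 (Eq.trans ?_ (map_zero (mfderiv (𝓡 n) (𝓡 n) φ.symm y)).symm)
  by_contra hne
  obtain ⟨u, hu, hpos⟩ := g.lorentzian (φ.symm y)
  have hall : ∀ w, g.val (φ.symm y) (mfderiv (𝓡 n) (𝓡 n) φ.symm y a) w = 0 := fun w => by
    obtain ⟨b, rfl⟩ := hb.2 w
    exact (g.form_eq_val φ y a b).symm.trans (h b)
  have := hpos _ (by rw [g.symm]; exact hall u) hne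
  rw [hall] at this
  exact lt_irrefl _ this

theorem contDiffOn_coeff' (hφ : φ ∈ atlas (EuclideanSpace ℝ (Fin n)) M) (i j : Fin n) :
    ContDiffOn ℝ 1 (g.coeff φ i j) φ.target :=
  g.contDiffOn_coeff φ hφ i j

theorem contDiffOn_form (hφ : φ ∈ atlas (EuclideanSpace ℝ (Fin n)) M) :
    ContDiffOn ℝ 1 (g.form φ) φ.target :=
  ContDiffOn.sum fun i _ => ContDiffOn.sum fun j _ =>
    (ContinuousLinearMap.toSpanSingleton ℝ _).contDiff.comp_contDiffOn (g.contDiffOn_coeff' hφ i j)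

theorem differentiableAt_form (hφ : φ ∈ atlas (EuclideanSpace ℝ (Fin n)) M)
    {y : EuclideanSpace ℝ (Fin n)} (hy : y ∈ φ.target) : DifferentiableAt ℝ (g.form φ) y :=
  ((g.contDiffOn_form hφ).contDiffAt (φ.open_target.mem_nhds hy)).differentiableAt (by simp)

theorem fderiv_form_single (hφ : φ ∈ atlas (EuclideanSpace ℝ (Fin n)) M)
    {y : EuclideanSpace ℝ (Fin n)} (hy : y ∈ φ.target) (l i j : Fin n) :
    fderiv ℝ (g.form φ) y (EuclideanSpace.single l 1) (EuclideanSpace.single i 1)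
      (EuclideanSpace.single j 1) = g.partialCoeff φ l i j y := by
  have h := ((g.differentiableAt_form hφ hy).hasFDerivAt.clm_apply
    (hasFDerivAt_const (EuclideanSpace.single i (1 : ℝ)) y)).clm_apply
    (hasFDerivAt_const (EuclideanSpace.single j (1 : ℝ)) y)
  have he : (fun x => g.form φ x (EuclideanSpace.single i (1 : ℝ))
      (EuclideanSpace.single j (1 : ℝ))) = g.coeff φ i j := by
    funext x; exact g.form_single x i j
  rw [he] at h
  rw [partialCoeff, h.fderiv]
  simp

/-- The Gram matrix of the coordinate fields. -/
noncomputable def gram (φ : OpenPartialHomeomorph M (EuclideanSpace ℝ (Fin n)))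
    (y : EuclideanSpace ℝ (Fin n)) : Matrix (Fin n) (Fin n) ℝ :=
  Matrix.of fun a b : Fin n => g.coeff φ a b y

theorem isUnit_det_gram (hφ : φ ∈ atlas (EuclideanSpace ℝ (Fin n)) M)
    {y : EuclideanSpace ℝ (Fin n)} (hy : y ∈ φ.target) : IsUnit (g.gram φ y).det := by
  rw [isUnit_iff_ne_zero]
  intro h0
  obtain ⟨v, hv, hv0⟩ := Matrix.exists_vecMul_eq_zero_iff.2 h0
  apply hv
  have : WithLp.toLp 2 v = (0 : EuclideanSpace ℝ (Fin n)) := by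
    refine g.eq_zero_of_form_eq_zero hφ hy fun b => ?_
    rw [form_apply, Finset.sum_comm]
    refine Finset.sum_eq_zero fun j _ => ?_
    have := congrFun hv0 j
    simp only [Matrix.vecMul, dotProduct, gram, Matrix.of_apply, Pi.zero_apply] at this
    rw [← Finset.sum_mul]
    simp only [mul_comm (g.coeff φ _ _ _)]
    rw [this, zero_mul]
  exact (WithLp.toLp_eq_zero 2).1 this

/-- The acceleration `-Γ(v, v)` of geodesics in the chart `φ`. -/
noncomputable def acceleration (φ : OpenPartialHomeomorph M (EuclideanSpace ℝ (Fin n)))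
    (z : EuclideanSpace ℝ (Fin n) × EuclideanSpace ℝ (Fin n)) : EuclideanSpace ℝ (Fin n) :=
  WithLp.toLp 2 fun k => -∑ i : Fin n, ∑ j : Fin n, g.christoffel φ k i j z.1 * z.2 i * z.2 j

theorem acceleration_apply (z : EuclideanSpace ℝ (Fin n) × EuclideanSpace ℝ (Fin n)) (k : Fin n) :
    g.acceleration φ z k =
      -∑ i : Fin n, ∑ j : Fin n, g.christoffel φ k i j z.1 * z.2 i * z.2 j := rfl

/-- Lowering the index cancels the inverse Gram matrix in the Christoffel symbols. What remains is a
contraction of first derivatives of the metric, and swapping the two velocity indices matches it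
with the derivative terms of the Lagrange form. -/
theorem lagrangeForm_acceleration (hφ : φ ∈ atlas (EuclideanSpace ℝ (Fin n)) M)
    {y : EuclideanSpace ℝ (Fin n)} (hy : y ∈ φ.target) (v w : EuclideanSpace ℝ (Fin n)) :
    lagrangeForm (g.form φ) y v (g.acceleration φ (y, v)) w = 0 := by
  have hlin : lagrangeForm (g.form φ) y v (g.acceleration φ (y, v)) w =
      ∑ l, w l * lagrangeForm (g.form φ) y v (g.acceleration φ (y, v))
        (EuclideanSpace.single l 1) := by
    conv_lhs => rw [← sum_smul_single w]
    simp only [lagrangeForm, map_sum, map_smul, sum_apply,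
      smul_apply, smul_eq_mul, mul_sub, mul_add, Finset.sum_sub_distrib,
      Finset.sum_add_distrib, Finset.mul_sum]
    simp only [mul_left_comm]
  rw [hlin]
  refine Finset.sum_eq_zero fun l _ => ?_
  let C : Fin n → ℝ := fun m => ∑ i, ∑ j,
    (g.partialCoeff φ i j m y + g.partialCoeff φ j i m y - g.partialCoeff φ m i j y) * v i * v j
  have hacc : ∀ k, g.acceleration φ (y, v) k = -(1 / 2) * ((g.gram φ y)⁻¹.mulVec C) k := fun k => by
    rw [acceleration_apply]
    simp only [christoffel, Matrix.mulVec, dotProduct, C, Finset.mul_sum, Finset.sum_mul]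
    rw [← Finset.sum_neg_distrib]
    simp only [← Finset.sum_neg_distrib]
    rw [Finset.sum_congr rfl fun i _ => Finset.sum_comm, Finset.sum_comm]
    refine Finset.sum_congr rfl fun m _ => Finset.sum_congr rfl fun i _ =>
      Finset.sum_congr rfl fun j _ => ?_
    simp only [gram]
    ring
  have h1 : g.form φ y (g.acceleration φ (y, v)) (EuclideanSpace.single l 1) = -(1 / 2) * C l := by
    rw [form_symm, form_apply]
    have : ∀ i j : Fin n, g.coeff φ i j y * (EuclideanSpace.single l (1 : ℝ)) i *
        g.acceleration φ (y, v) j = if i = l then g.coeff φ l j y * g.acceleration φ (y, v) j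
          else 0 := fun i j => by
      by_cases h : i = l
      · subst h; simp
      · simp [h]
    simp only [this]
    rw [Finset.sum_comm]
    simp only [Finset.sum_ite_eq', Finset.mem_univ, if_true, hacc]
    have h2 : (g.gram φ y).mulVec ((g.gram φ y)⁻¹.mulVec C) = C := by
      rw [Matrix.mulVec_mulVec, Matrix.mul_nonsing_inv _ (g.isUnit_det_gram hφ hy),
        Matrix.one_mulVec]
    have h3 := congrFun h2 l
    conv_rhs => rw [← h3]
    simp only [Matrix.mulVec, dotProduct, Finset.mul_sum]
    refine Finset.sum_congr rfl fun j _ => Finset.sum_congr rfl fun k _ => ?_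
    simp only [gram, Matrix.of_apply]
    ring
  have h2 : fderiv ℝ (g.form φ) y v v (EuclideanSpace.single l 1) =
      ∑ i, ∑ j, v i * v j * g.partialCoeff φ i j l y := by
    conv_lhs => rw [← sum_smul_single v]
    simp only [map_sum, map_smul, sum_apply,
      smul_apply, smul_eq_mul, fderiv_form_single g hφ hy, Finset.mul_sum]
    rw [Finset.sum_comm]
    refine Finset.sum_congr rfl fun j _ => Finset.sum_congr rfl fun k _ => ?_
    ring
  have h3 : fderiv ℝ (g.form φ) y (EuclideanSpace.single l 1) v v =
      ∑ i, ∑ j, v i * v j * g.partialCoeff φ l i j y := by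
    conv_lhs => rw [← sum_smul_single v]
    simp only [map_sum, map_smul, sum_apply,
      smul_apply, smul_eq_mul, fderiv_form_single g hφ hy, Finset.mul_sum]
    rw [Finset.sum_comm]
    refine Finset.sum_congr rfl fun j _ => Finset.sum_congr rfl fun k _ => ?_
    ring
  have h4 : C l = 2 * (∑ i, ∑ j, v i * v j * g.partialCoeff φ i j l y) -
      ∑ i, ∑ j, v i * v j * g.partialCoeff φ l i j y := by
    have : C l = (∑ i, ∑ j, v i * v j * g.partialCoeff φ i j l y) +
        (∑ i, ∑ j, v i * v j * g.partialCoeff φ j i l y) -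
        ∑ i, ∑ j, v i * v j * g.partialCoeff φ l i j y := by
      simp only [C, ← Finset.sum_add_distrib, ← Finset.sum_sub_distrib]
      refine Finset.sum_congr rfl fun j _ => Finset.sum_congr rfl fun k _ => ?_
      ring
    rw [this, two_mul]
    congr 2
    rw [Finset.sum_comm]
    refine Finset.sum_congr rfl fun j _ => Finset.sum_congr rfl fun k _ => ?_
    ring
  rw [lagrangeForm, h1, h2, h3, h4]
  ring

/-- The Euler-Lagrange equation determines the acceleration. -/
theorem eq_acceleration_of_lagrangeForm (hφ : φ ∈ atlas (EuclideanSpace ℝ (Fin n)) M)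
    {y : EuclideanSpace ℝ (Fin n)} (hy : y ∈ φ.target) {v a : EuclideanSpace ℝ (Fin n)}
    (h : ∀ w, lagrangeForm (g.form φ) y v a w = 0) : a = g.acceleration φ (y, v) := by
  rw [← sub_eq_zero]
  refine g.eq_zero_of_form_eq_zero hφ hy fun b => ?_
  have h1 := h b
  have h2 := g.lagrangeForm_acceleration hφ hy v b
  simp only [lagrangeForm] at h1 h2
  rw [map_sub, sub_apply]
  linarith

theorem continuousOn_partialCoeff (hφ : φ ∈ atlas (EuclideanSpace ℝ (Fin n)) M) (l i j : Fin n) :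
    ContinuousOn (g.partialCoeff φ l i j) φ.target :=
  ((g.contDiffOn_coeff' hφ i j).continuousOn_fderiv_of_isOpen φ.open_target (by simp)).clm_apply
    continuousOn_const

theorem continuousOn_christoffel (hφ : φ ∈ atlas (EuclideanSpace ℝ (Fin n)) M) (k i j : Fin n) :
    ContinuousOn (g.christoffel φ k i j) φ.target := by
  have hgram : ContinuousOn (g.gram φ) φ.target :=
    continuousOn_pi.2 fun a => continuousOn_pi.2 fun b => (g.contDiffOn_coeff' hφ a b).continuousOn
  have hinv : ContinuousOn (fun y => (g.gram φ y)⁻¹) φ.target := by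
    simp only [Matrix.inv_def, Ring.inverse_eq_inv']
    exact ((continuous_id.matrix_det.comp_continuousOn hgram).inv₀
      fun y hy => (g.isUnit_det_gram hφ hy).ne_zero).smul
      (continuous_id.matrix_adjugate.comp_continuousOn hgram)
  refine continuousOn_const.mul (continuousOn_finsetSum _ fun l _ => ContinuousOn.mul ?_ ?_)
  · exact continuousOn_pi.1 (continuousOn_pi.1 hinv k) l
  · exact ((g.continuousOn_partialCoeff hφ _ _ _).add (g.continuousOn_partialCoeff hφ _ _ _)).sub
      (g.continuousOn_partialCoeff hφ _ _ _)

theorem continuousOn_acceleration (hφ : φ ∈ atlas (EuclideanSpace ℝ (Fin n)) M) :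
    ContinuousOn (g.acceleration φ) (φ.target ×ˢ univ) := by
  refine (PiLp.continuous_toLp 2 _).comp_continuousOn (continuousOn_pi.2 fun k => ?_)
  refine (continuousOn_finsetSum _ fun i _ => continuousOn_finsetSum _ fun j _ => ?_).neg
  refine ContinuousOn.mul (ContinuousOn.mul ?_ ?_) ?_
  · exact (g.continuousOn_christoffel hφ k i j).comp continuousOn_fst fun z hz => hz.1
  · fun_prop
  · fun_prop

/-- The geodesic spray in the chart `φ`. -/
noncomputable def spray (φ : OpenPartialHomeomorph M (EuclideanSpace ℝ (Fin n)))
    (z : EuclideanSpace ℝ (Fin n) × EuclideanSpace ℝ (Fin n)) :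
    EuclideanSpace ℝ (Fin n) × EuclideanSpace ℝ (Fin n) :=
  (z.2, g.acceleration φ z)

theorem continuousOn_spray (hφ : φ ∈ atlas (EuclideanSpace ℝ (Fin n)) M) :
    ContinuousOn (g.spray φ) (φ.target ×ˢ univ) :=
  continuousOn_snd.prodMk (g.continuousOn_acceleration hφ)

/-- Geodesics have constant energy. -/
theorem hasDerivWithinAt_energy (hφ : φ ∈ atlas (EuclideanSpace ℝ (Fin n)) M)
    {z : ℝ → EuclideanSpace ℝ (Fin n) × EuclideanSpace ℝ (Fin n)} {s : Set ℝ}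
    (hz : IsSolutionOn (g.spray φ) z s) {t : ℝ} (ht : t ∈ s) (hm : (z t).1 ∈ φ.target) :
    HasDerivWithinAt (fun τ => g.form φ (z τ).1 (z τ).2 (z τ).2) 0 s t := by
  have h1 : HasDerivWithinAt (fun τ => (z τ).1) (z t).2 s t := (hz t ht).fst
  have h2 : HasDerivWithinAt (fun τ => (z τ).2) (g.acceleration φ (z t)) s t := (hz t ht).snd
  have h3 : HasDerivWithinAt (fun τ => g.form φ (z τ).1) (fderiv ℝ (g.form φ) (z t).1 (z t).2) s t :=
    HasFDerivAt.comp_hasDerivWithinAt (l := g.form φ) t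
      (g.differentiableAt_form hφ hm).hasFDerivAt h1
  have h4 := (h3.clm_apply h2).clm_apply h2
  -- Tested against the velocity itself, the Euler–Lagrange equation says exactly that the
  -- derivative of the energy vanishes.
  have h5 := g.lagrangeForm_acceleration hφ hm (z t).2 (z t).2
  rw [lagrangeForm] at h5
  refine h4.congr_deriv ?_
  simp only [add_apply]
  rw [g.form_symm _ (z t).2]
  linarith

theorem energy_eq (hφ : φ ∈ atlas (EuclideanSpace ℝ (Fin n)) M)
    {z : ℝ → EuclideanSpace ℝ (Fin n) × EuclideanSpace ℝ (Fin n)} {a b : ℝ}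
    (hz : IsSolutionOn (g.spray φ) z (Icc a b)) (hm : ∀ t ∈ Icc a b, (z t).1 ∈ φ.target)
    {t u : ℝ} (ht : t ∈ Icc a b) (hu : u ∈ Icc a b) :
    g.form φ (z t).1 (z t).2 (z t).2 = g.form φ (z u).1 (z u).2 (z u).2 := by
  have := (convex_Icc a b).norm_image_sub_le_of_norm_hasDerivWithin_le (C := 0)
    (fun t ht => g.hasDerivWithinAt_energy hφ hz ht (hm t ht)) (by simp) hu ht
  rw [zero_mul] at this
  exact sub_eq_zero.1 (norm_le_zero_iff.1 this)

end C1LorentzMetric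

theorem OpenPartialHomeomorph.transition_mem_nhds {X H H' : Type*} [TopologicalSpace X]
    [TopologicalSpace H] [TopologicalSpace H'] {φ : OpenPartialHomeomorph X H}
    {ψ : OpenPartialHomeomorph X H'} {y : H} (hy : y ∈ φ.target)
    (hy' : φ.symm y ∈ ψ.source) : ∀ᶠ x in 𝓝 y, x ∈ φ.target ∧ φ.symm x ∈ ψ.source :=
  (φ.open_target.eventually_mem hy).and
    ((φ.symm.continuousAt hy).eventually (ψ.open_source.eventually_mem hy'))

/-! ### Changes of chart; geodesics as spray solutions -/

namespace C1LorentzMetric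

variable {n : ℕ} {M : Type*} [TopologicalSpace M]
  [ChartedSpace (EuclideanSpace ℝ (Fin n)) M] [IsManifold (𝓡 n) ∞ M]
  (g : C1LorentzMetric n M) {φ ψ : OpenPartialHomeomorph M (EuclideanSpace ℝ (Fin n))}

/-- Needed for base points such as `φ.symm (φ x)`, equal to `x` only propositionally. All tangent
spaces unfold to the same Euclidean space, so the vectors need no cast. -/
theorem val_congr {x x' : M} (h : x' = x) (v w : EuclideanSpace ℝ (Fin n)) :
    g.val x' v w = g.val x v w := by subst h; rfl

theorem mfderiv_symm_mfderiv (hφ : φ ∈ atlas (EuclideanSpace ℝ (Fin n)) M) {x : M}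
    (hx : x ∈ φ.source) (v : EuclideanSpace ℝ (Fin n)) :
    (mfderiv (𝓡 n) (𝓡 n) φ.symm (φ x) (mfderiv (𝓡 n) (𝓡 n) φ x v) : EuclideanSpace ℝ (Fin n)) =
      v :=
  congrArg (fun A : EuclideanSpace ℝ (Fin n) →L[ℝ] EuclideanSpace ℝ (Fin n) => A v)
    ((mdifferentiable_of_mem_atlas hφ).symm_comp_deriv hx)

theorem contMDiffOn_of_mem_atlas (hφ : φ ∈ atlas (EuclideanSpace ℝ (Fin n)) M) :
    ContMDiffOn (𝓡 n) (𝓡 n) 2 φ φ.source :=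
  (contMDiffOn_of_mem_maximalAtlas (n := ∞)
    (IsManifold.subset_maximalAtlas hφ)).of_le (WithTop.coe_le_coe.2 (le_top : (2 : ℕ∞) ≤ ⊤))

theorem contMDiffOn_symm_of_mem_atlas (hφ : φ ∈ atlas (EuclideanSpace ℝ (Fin n)) M) :
    ContMDiffOn (𝓡 n) (𝓡 n) 2 φ.symm φ.target :=
  (contMDiffOn_symm_of_mem_maximalAtlas (n := ∞)
    (IsManifold.subset_maximalAtlas hφ)).of_le (WithTop.coe_le_coe.2 (le_top : (2 : ℕ∞) ≤ ⊤))

section Transition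

variable (hφ : φ ∈ atlas (EuclideanSpace ℝ (Fin n)) M)
  (hψ : ψ ∈ atlas (EuclideanSpace ℝ (Fin n)) M)
  {y : EuclideanSpace ℝ (Fin n)} (hy : y ∈ φ.target) (hy' : φ.symm y ∈ ψ.source)

include hφ hψ hy hy'

theorem contDiffAt_transition : ContDiffAt ℝ 2 (ψ ∘ φ.symm) y := by
  refine contMDiffAt_iff_contDiffAt.1 ?_
  exact ((contMDiffOn_of_mem_atlas hψ).contMDiffAt (ψ.open_source.mem_nhds hy')).comp y
    ((contMDiffOn_symm_of_mem_atlas hφ).contMDiffAt (φ.open_target.mem_nhds hy))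

theorem fderiv_transition (v : EuclideanSpace ℝ (Fin n)) :
    fderiv ℝ (ψ ∘ φ.symm) y v =
      mfderiv (𝓡 n) (𝓡 n) ψ (φ.symm y) (mfderiv (𝓡 n) (𝓡 n) φ.symm y v) := by
  rw [← mfderiv_eq_fderiv]
  have := mfderiv_comp (I := 𝓡 n) (I' := 𝓡 n) (I'' := 𝓡 n) y
    ((mdifferentiable_of_mem_atlas hψ).mdifferentiableAt hy')
    ((mdifferentiable_of_mem_atlas hφ).mdifferentiableAt_symm hy)
  exact congrArg
    (fun A : EuclideanSpace ℝ (Fin n) →L[ℝ] EuclideanSpace ℝ (Fin n) => A v) this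

theorem surjective_fderiv_transition : Function.Surjective (fderiv ℝ (ψ ∘ φ.symm) y) := by
  intro w
  obtain ⟨u, hu⟩ := (mdifferentiable_of_mem_atlas hψ).mfderiv_surjective hy' w
  obtain ⟨v, hv⟩ := (mdifferentiable_of_mem_atlas hφ).symm.mfderiv_surjective (x := y) hy u
  refine ⟨v, (fderiv_transition hφ hψ hy hy' v).trans ?_⟩
  rw [← hu, ← hv]

/-- Both sides evaluate the same metric on the same tangent vectors, since the differentials of `ψ`
and `ψ.symm` cancel. This supplies the pullback hypothesis of `lagrangeForm_pullback`. -/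
theorem form_transition (a b : EuclideanSpace ℝ (Fin n)) :
    g.form φ y a b = g.form ψ ((ψ ∘ φ.symm) y) (fderiv ℝ (ψ ∘ φ.symm) y a)
      (fderiv ℝ (ψ ∘ φ.symm) y b) := by
  rw [form_eq_val, form_eq_val, fderiv_transition hφ hψ hy hy', fderiv_transition hφ hψ hy hy']
  have e := fun v => mfderiv_symm_mfderiv hψ hy' v
  refine Eq.trans ?_ (g.val_congr (ψ.left_inv hy') _ _).symm
  exact congrArg₂ (fun u v : EuclideanSpace ℝ (Fin n) => g.val (φ.symm y) u v) (e _).symm (e _).symm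

end Transition

/-- The lift of a curve to the tangent bundle, in the chart `φ`. -/
noncomputable def chartLift (φ : OpenPartialHomeomorph M (EuclideanSpace ℝ (Fin n))) (γ : ℝ → M)
    (J : Set ℝ) (t : ℝ) : EuclideanSpace ℝ (Fin n) × EuclideanSpace ℝ (Fin n) :=
  (φ (γ t), derivWithin (φ ∘ γ) J t)

theorem derivWithin_chart_comp (hφ : φ ∈ atlas (EuclideanSpace ℝ (Fin n)) M) {γ : ℝ → M}
    {J : Set ℝ} {t : ℝ} (hγ : MDifferentiableWithinAt 𝓘(ℝ, ℝ) (𝓡 n) γ J t)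
    (hJ : UniqueDiffWithinAt ℝ J t) (hs : γ t ∈ φ.source) :
    derivWithin (φ ∘ γ) J t =
      mfderiv (𝓡 n) (𝓡 n) φ (γ t) (mfderivWithin 𝓘(ℝ, ℝ) (𝓡 n) γ J t (1 : ℝ)) := by
  have := mfderiv_comp_mfderivWithin (I := 𝓘(ℝ, ℝ)) (I' := 𝓡 n) (I'' := 𝓡 n) t
    ((mdifferentiable_of_mem_atlas hφ).mdifferentiableAt hs) hγ hJ.uniqueMDiffWithinAt
  rw [← fderivWithin_derivWithin, ← mfderivWithin_eq_fderivWithin]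
  exact congrArg (fun A : ℝ →L[ℝ] EuclideanSpace ℝ (Fin n) => A 1) this

theorem mfderivWithin_eq_mfderiv_symm (hφ : φ ∈ atlas (EuclideanSpace ℝ (Fin n)) M) {γ : ℝ → M}
    {J : Set ℝ} {t : ℝ} (hγ : MDifferentiableWithinAt 𝓘(ℝ, ℝ) (𝓡 n) γ J t)
    (hJ : UniqueDiffWithinAt ℝ J t) (hs : γ t ∈ φ.source) :
    (mfderivWithin 𝓘(ℝ, ℝ) (𝓡 n) γ J t (1 : ℝ) : EuclideanSpace ℝ (Fin n)) =
      mfderiv (𝓡 n) (𝓡 n) φ.symm (φ (γ t)) (derivWithin (φ ∘ γ) J t) := by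
  refine (mfderiv_symm_mfderiv hφ hs _).symm.trans ?_
  exact congrArg (fun v : EuclideanSpace ℝ (Fin n) => (mfderiv (𝓡 n) (𝓡 n) φ.symm (φ (γ t)) v :
    EuclideanSpace ℝ (Fin n))) (derivWithin_chart_comp hφ hγ hJ hs).symm

theorem derivWithin_transition (hφ : φ ∈ atlas (EuclideanSpace ℝ (Fin n)) M)
    (hψ : ψ ∈ atlas (EuclideanSpace ℝ (Fin n)) M) {γ : ℝ → M}
    {J : Set ℝ} {t : ℝ} (hγ : MDifferentiableWithinAt 𝓘(ℝ, ℝ) (𝓡 n) γ J t)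
    (hJ : UniqueDiffWithinAt ℝ J t) (hs : γ t ∈ φ.source) (hs' : γ t ∈ ψ.source) :
    derivWithin (ψ ∘ γ) J t =
      fderiv ℝ (ψ ∘ φ.symm) (φ (γ t)) (derivWithin (φ ∘ γ) J t) := by
  have hl := φ.left_inv hs
  rw [derivWithin_chart_comp hψ hγ hJ hs', fderiv_transition hφ hψ (φ.map_source hs) (by rwa [hl])]
  have := mfderivWithin_eq_mfderiv_symm hφ hγ hJ hs
  have h2 : ∀ x' (_ : x' = γ t) (v : EuclideanSpace ℝ (Fin n)),
      (mfderiv (𝓡 n) (𝓡 n) ψ x' v : EuclideanSpace ℝ (Fin n)) =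
        mfderiv (𝓡 n) (𝓡 n) ψ (γ t) v := by rintro _ rfl _; rfl
  refine Eq.trans ?_ (h2 _ hl _).symm
  exact congrArg (fun v : EuclideanSpace ℝ (Fin n) => mfderiv (𝓡 n) (𝓡 n) ψ (γ t) v) this

theorem val_curveVelocity (hφ : φ ∈ atlas (EuclideanSpace ℝ (Fin n)) M) {γ : ℝ → M}
    {J : Set ℝ} {t : ℝ} (hγ : MDifferentiableWithinAt 𝓘(ℝ, ℝ) (𝓡 n) γ J t)
    (hJ : UniqueDiffWithinAt ℝ J t) (hs : γ t ∈ φ.source) :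
    g.val (γ t) (curveVelocity (n := n) γ J t).2 (curveVelocity (n := n) γ J t).2 =
      g.form φ (chartLift φ γ J t).1 (chartLift φ γ J t).2 (chartLift φ γ J t).2 := by
  rw [form_eq_val]
  refine Eq.trans ?_ (g.val_congr (φ.left_inv hs) _ _).symm
  have := mfderivWithin_eq_mfderiv_symm hφ hγ hJ hs
  exact congrArg₂ (fun u v : EuclideanSpace ℝ (Fin n) => g.val (γ t) u v) this this

variable {g}

theorem IsGeodesicOn.mdifferentiableWithinAt {γ : ℝ → M} {J : Set ℝ} (h : g.IsGeodesicOn γ J)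
    {t : ℝ} (ht : t ∈ J) : MDifferentiableWithinAt 𝓘(ℝ, ℝ) (𝓡 n) γ J t :=
  (h.1 t ht).mdifferentiableWithinAt (by simp)

/-- In a chart, a geodesic is a solution of the geodesic spray. -/
theorem IsGeodesicOn.isSolutionOn_chartLift {γ : ℝ → M} {J : Set ℝ} (h : g.IsGeodesicOn γ J)
    (hJ : UniqueDiffOn ℝ J) {s : Set ℝ} (hsub : s ⊆ J)
    (hφ : φ ∈ atlas (EuclideanSpace ℝ (Fin n)) M) (hs : MapsTo γ s φ.source) :
    IsSolutionOn (g.spray φ) (chartLift φ γ J) s := by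
  intro t ht
  have hC : ContDiffWithinAt ℝ 2 (φ ∘ γ) J t := by
    refine contMDiffWithinAt_iff_contDiffWithinAt.1 ?_
    exact ((contMDiffOn_of_mem_atlas hφ).contMDiffAt
      (φ.open_source.mem_nhds (hs ht))).comp_contMDiffWithinAt t (h.1 t (hsub ht))
  have h1 : HasDerivWithinAt (φ ∘ γ) (derivWithin (φ ∘ γ) J t) J t :=
    (hC.differentiableWithinAt (by simp)).hasDerivWithinAt
  have h2 : HasDerivWithinAt (derivWithin (φ ∘ γ) J)
      (derivWithin (derivWithin (φ ∘ γ) J) J t) J t := by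
    refine DifferentiableWithinAt.hasDerivWithinAt ?_
    have := (hC.fderivWithin_right (m := 1) hJ (by norm_num) (hsub ht)).differentiableWithinAt
      (by simp)
    exact (this.clm_apply (differentiableWithinAt_const (1 : ℝ)))
  have h3 : derivWithin (derivWithin (φ ∘ γ) J) J t = g.acceleration φ (chartLift φ γ J t) := by
    ext k
    rw [acceleration_apply]
    exact eq_neg_of_add_eq_zero_left (h.2 φ hφ t (hsub ht) (hs ht) k)
  rw [h3] at h2
  exact (h1.prodMk h2).mono hsub

section OfChart

variable {z : ℝ → EuclideanSpace ℝ (Fin n) × EuclideanSpace ℝ (Fin n)} {s : Set ℝ}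
  (hφ : φ ∈ atlas (EuclideanSpace ℝ (Fin n)) M)
  (hz : IsSolutionOn (g.spray φ) z s) (hs : UniqueDiffOn ℝ s) (hm : ∀ t ∈ s, (z t).1 ∈ φ.target)

include hφ hz hs hm

theorem mfderivWithin_symm_comp {t : ℝ} (ht : t ∈ s) :
    (mfderivWithin 𝓘(ℝ, ℝ) (𝓡 n) (fun τ => φ.symm (z τ).1) s t (1 : ℝ) :
      EuclideanSpace ℝ (Fin n)) = mfderiv (𝓡 n) (𝓡 n) φ.symm (z t).1 (z t).2 := by
  have h1 : HasDerivWithinAt (fun τ => (z τ).1) (z t).2 s t := (hz t ht).fst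
  have := mfderiv_comp_mfderivWithin (I := 𝓘(ℝ, ℝ)) (I' := 𝓡 n) (I'' := 𝓡 n)
    (f := fun τ => (z τ).1) t
    ((mdifferentiable_of_mem_atlas hφ).mdifferentiableAt_symm (hm t ht))
    h1.differentiableWithinAt.mdifferentiableWithinAt (hs t ht).uniqueMDiffWithinAt
  have h2 := congrArg (fun A : ℝ →L[ℝ] EuclideanSpace ℝ (Fin n) => A 1) this
  refine Eq.trans h2 ?_
  have h3 : mfderivWithin 𝓘(ℝ, ℝ) (𝓡 n) (fun τ => (z τ).1) s t (1 : ℝ) = (z t).2 := by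
    have h4 : fderivWithin ℝ (fun τ => (z τ).1) s t (1 : ℝ) = (z t).2 :=
      fderivWithin_derivWithin.trans (h1.derivWithin (hs t ht))
    exact (congrArg (fun A : ℝ →L[ℝ] EuclideanSpace ℝ (Fin n) => A 1)
      mfderivWithin_eq_fderivWithin).trans h4
  exact congrArg (fun v : EuclideanSpace ℝ (Fin n) => mfderiv (𝓡 n) (𝓡 n) φ.symm (z t).1 v) h3

theorem curveVelocity_symm_comp {t : ℝ} (ht : t ∈ s) :
    curveVelocity (n := n) (fun τ => φ.symm (z τ).1) s t =
      (⟨φ.symm (z t).1, mfderiv (𝓡 n) (𝓡 n) φ.symm (z t).1 (z t).2⟩ : TangentBundle (𝓡 n) M) :=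
  congrArg (fun v : EuclideanSpace ℝ (Fin n) => (⟨φ.symm (z t).1, v⟩ : TangentBundle (𝓡 n) M))
    (mfderivWithin_symm_comp hφ hz hs hm ht)

/-- A solution of the geodesic spray of a chart is a geodesic. -/
theorem isGeodesicOn_symm_comp : g.IsGeodesicOn (fun τ => φ.symm (z τ).1) s := by
  have h1 : ∀ t ∈ s, HasDerivWithinAt (fun τ => (z τ).1) (z t).2 s t := fun t ht => (hz t ht).fst
  have h2 : ∀ t ∈ s, HasDerivWithinAt (fun τ => (z τ).2) (g.acceleration φ (z t)) s t :=
    fun t ht => (hz t ht).snd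
  constructor
  -- Regularity by bootstrapping: continuous acceleration makes the velocity `C¹`, hence the
  -- position `C²`.
  · have hacc : ContinuousOn (fun t => g.acceleration φ (z t)) s :=
      (g.continuousOn_acceleration hφ).comp hz.continuousOn fun t ht => ⟨hm t ht, mem_univ _⟩
    have hv : ContDiffOn ℝ 1 (fun τ => (z τ).2) s := by
      rw [show (1 : WithTop ℕ∞) = 0 + 1 from rfl, contDiffOn_succ_iff_derivWithin hs]
      refine ⟨fun t ht => (h2 t ht).differentiableWithinAt, by simp, ?_⟩
      rw [contDiffOn_zero]
      exact hacc.congr fun t ht => (h2 t ht).derivWithin (hs t ht)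
    have hx : ContDiffOn ℝ 2 (fun τ => (z τ).1) s := by
      rw [show (2 : WithTop ℕ∞) = 1 + 1 from by norm_num, contDiffOn_succ_iff_derivWithin hs]
      refine ⟨fun t ht => (h1 t ht).differentiableWithinAt, by simp, ?_⟩
      exact hv.congr fun t ht => (h1 t ht).derivWithin (hs t ht)
    exact (contMDiffOn_symm_of_mem_atlas hφ).comp hx.contMDiffOn hm
  · intro ψ hψ t ht hψt k
    have hy := hm t ht
    have hev : ∀ᶠ τ in 𝓝[s] t, (z τ).1 ∈ φ.target ∧ φ.symm (z τ).1 ∈ ψ.source :=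
      (h1 t ht).continuousWithinAt.eventually (OpenPartialHomeomorph.transition_mem_nhds hy hψt)
    have hd1 : ∀ τ ∈ s, φ.symm (z τ).1 ∈ ψ.source →
        derivWithin (ψ ∘ fun τ => φ.symm (z τ).1) s τ =
          fderiv ℝ (ψ ∘ φ.symm) (z τ).1 (z τ).2 := fun τ hτ hτ' => by
      have := HasFDerivAt.comp_hasDerivWithinAt (l := ψ ∘ φ.symm) τ
        ((contDiffAt_transition hφ hψ (hm τ hτ) hτ').differentiableAt (by simp)).hasFDerivAt
        (h1 τ hτ)
      exact this.derivWithin (hs τ hτ)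
    have hd2 : derivWithin (derivWithin (ψ ∘ fun τ => φ.symm (z τ).1) s) s t =
        fderiv ℝ (fderiv ℝ (ψ ∘ φ.symm)) (z t).1 (z t).2 (z t).2 +
          fderiv ℝ (ψ ∘ φ.symm) (z t).1 (g.acceleration φ (z t)) := by
      have hT := contDiffAt_transition hφ hψ hy hψt
      have h3 := HasFDerivAt.comp_hasDerivWithinAt (l := fderiv ℝ (ψ ∘ φ.symm)) t
        ((hT.fderiv_right (m := 1) (by norm_num)).differentiableAt (by simp)).hasFDerivAt
        (h1 t ht)
      have h4 := h3.clm_apply (h2 t ht)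
      refine (h4.congr_of_eventuallyEq ?_ (hd1 t ht hψt)).derivWithin (hs t ht)
      filter_upwards [hev, self_mem_nhdsWithin] with τ hτ hτs
      exact hd1 τ hτs hτ.2
    -- The transformed velocity and acceleration satisfy the Euler–Lagrange equation of `ψ`: every
    -- test vector is the image of one in `φ`. Nondegeneracy then forces the acceleration prescribed
    -- by `ψ`.
    have hψy : (ψ ∘ φ.symm) (z t).1 ∈ ψ.target := ψ.map_source hψt
    have hkey := g.eq_acceleration_of_lagrangeForm hψ hψy
      (v := fderiv ℝ (ψ ∘ φ.symm) (z t).1 (z t).2)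
      (a := fderiv ℝ (fderiv ℝ (ψ ∘ φ.symm)) (z t).1 (z t).2 (z t).2 +
          fderiv ℝ (ψ ∘ φ.symm) (z t).1 (g.acceleration φ (z t))) (fun w => by
        obtain ⟨w, rfl⟩ := surjective_fderiv_transition hφ hψ hy hψt w
        rw [← lagrangeForm_pullback (contDiffAt_transition hφ hψ hy hψt)
          (g.differentiableAt_form hφ hy) (g.differentiableAt_form hψ hψy) ?_ (g.form_symm _)]
        · exact g.lagrangeForm_acceleration hφ hy (z t).2 w
        · filter_upwards [OpenPartialHomeomorph.transition_mem_nhds hy hψt] with x hx a b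
          exact g.form_transition hφ hψ hx.1 hx.2 a b)
    rw [hd2, hkey, acceleration_apply, hd1 t ht hψt]
    exact neg_add_cancel _

theorem isCausalGeodesicOn_symm_comp
    (hc : ∀ t ∈ s, g.form φ (z t).1 (z t).2 (z t).2 ≤ 0) :
    g.IsCausalGeodesicOn (fun τ => φ.symm (z τ).1) s := by
  refine ⟨isGeodesicOn_symm_comp hφ hz hs hm, fun t ht => ?_⟩
  have h1 := mfderivWithin_symm_comp hφ hz hs hm ht
  refine le_of_eq_of_le ?_ (hc t ht)
  rw [form_eq_val]
  exact congrArg₂ (fun u v : EuclideanSpace ℝ (Fin n) => g.val (φ.symm (z t).1) u v) h1 h1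

end OfChart

end C1LorentzMetric

/-! ### Forward uniqueness in a chart -/

namespace C1LorentzMetric

variable {n : ℕ} {M : Type*} [TopologicalSpace M]
  [ChartedSpace (EuclideanSpace ℝ (Fin n)) M] [IsManifold (𝓡 n) ∞ M]
  {g : C1LorentzMetric n M} {φ : OpenPartialHomeomorph M (EuclideanSpace ℝ (Fin n))}

theorem acceleration_smul (y v : EuclideanSpace ℝ (Fin n)) (c : ℝ) :
    g.acceleration φ (y, c • v) = c ^ 2 • g.acceleration φ (y, v) := by
  ext k
  simp only [acceleration_apply, PiLp.smul_apply, smul_eq_mul, mul_neg, Finset.mul_sum]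
  refine congrArg _ (Finset.sum_congr rfl fun i _ => Finset.sum_congr rfl fun j _ => ?_)
  ring

/-- The acceleration is homogeneous of degree two in the velocity, so a bound over the compact unit
ball of velocities scales to all of them. -/
theorem exists_norm_acceleration_le (hφ : φ ∈ atlas (EuclideanSpace ℝ (Fin n)) M)
    {K : Set (EuclideanSpace ℝ (Fin n))} (hK : IsCompact K) (hKt : K ⊆ φ.target) :
    ∃ C : ℝ, 0 ≤ C ∧ ∀ y ∈ K, ∀ v, ‖g.acceleration φ (y, v)‖ ≤ C * ‖v‖ ^ 2 := by
  obtain ⟨C, hC⟩ := (hK.prod (isCompact_closedBall (0 : EuclideanSpace ℝ (Fin n)) 1)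
    ).exists_bound_of_continuousOn ((g.continuousOn_acceleration hφ).mono
      (prod_mono hKt (subset_univ _)))
  refine ⟨max C 0, le_max_right _ _, fun y hy v => ?_⟩
  have h1 : v = ‖v‖ • (‖v‖⁻¹ • v) := by
    rcases eq_or_ne v 0 with rfl | h
    · simp
    · rw [smul_inv_smul₀ (norm_ne_zero_iff.2 h)]
  have h2 : ‖v‖⁻¹ • v ∈ Metric.closedBall (0 : EuclideanSpace ℝ (Fin n)) 1 := by
    rw [mem_closedBall_zero_iff, norm_smul, norm_inv, norm_norm]
    exact inv_mul_le_one
  conv_lhs => rw [h1]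
  rw [acceleration_smul, norm_smul, norm_pow, norm_norm, mul_comm]
  exact mul_le_mul_of_nonneg_right ((hC (y, _) ⟨hy, h2⟩).trans (le_max_left _ _)) (by positivity)

/-- A geodesic with vanishing initial velocity is constant. -/
theorem eqOn_const_of_velocity_eq_zero (hφ : φ ∈ atlas (EuclideanSpace ℝ (Fin n)) M)
    {z : ℝ → EuclideanSpace ℝ (Fin n) × EuclideanSpace ℝ (Fin n)} {b : ℝ}
    (hz : IsSolutionOn (g.spray φ) z (Icc 0 b)) (hm : ∀ t ∈ Icc 0 b, (z t).1 ∈ φ.target)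
    (h0 : (z 0).2 = 0) : ∀ t ∈ Icc 0 b, z t = z 0 := by
  have h1 : ∀ t ∈ Icc 0 b, HasDerivWithinAt (fun τ => (z τ).1) (z t).2 (Icc 0 b) t :=
    fun t ht => (hz t ht).fst
  have h2 : ∀ t ∈ Icc 0 b,
      HasDerivWithinAt (fun τ => (z τ).2) (g.acceleration φ (z t)) (Icc 0 b) t :=
    fun t ht => (hz t ht).snd
  obtain ⟨C, hC0, hC⟩ := exists_norm_acceleration_le (g := g) hφ
    (isCompact_Icc.image_of_continuousOn hz.continuousOn.fst) (image_subset_iff.2 hm)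
  obtain ⟨B, hB⟩ := isCompact_Icc.exists_bound_of_continuousOn hz.continuousOn.snd
  -- On a compact interval one factor of the quadratic bound is at most `B`; the resulting linear
  -- bound allows Grönwall's argument.
  have hv : ∀ t ∈ Icc 0 b, (z t).2 = 0 := by
    refine eq_zero_of_abs_deriv_le_mul_abs_self_of_eq_zero_right (K := C * B)
      (f' := fun t => g.acceleration φ (z t))
      hz.continuousOn.snd (fun t ht => ?_) h0 fun t ht => ?_
    · exact (h2 t ⟨ht.1, ht.2.le⟩).mono_of_mem_nhdsWithin (Icc_mem_nhdsGE_of_mem ht)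
    · have ht' : t ∈ Icc 0 b := ⟨ht.1, ht.2.le⟩
      refine (hC _ (mem_image_of_mem _ ht') (z t).2).trans ?_
      rw [pow_two, ← mul_assoc]
      exact mul_le_mul_of_nonneg_right (mul_le_mul_of_nonneg_left (hB t ht') hC0) (norm_nonneg _)
  intro t ht
  have hx := (convex_Icc 0 b).norm_image_sub_le_of_norm_hasDerivWithin_le (C := 0) h1
    (fun t ht => by rw [hv t ht, norm_zero]) (left_mem_Icc.2 (ht.1.trans ht.2)) ht
  rw [zero_mul] at hx
  exact Prod.ext (sub_eq_zero.1 (norm_le_zero_iff.1 hx)) ((hv t ht).trans h0.symm)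

/-- The velocity component of a spray solution is the derivative of its position component. -/
theorem eqOn_of_eqOn_fst {z₁ z₂ : ℝ → EuclideanSpace ℝ (Fin n) × EuclideanSpace ℝ (Fin n)}
    {s : Set ℝ} (hs : UniqueDiffOn ℝ s) (hz₁ : IsSolutionOn (g.spray φ) z₁ s)
    (hz₂ : IsSolutionOn (g.spray φ) z₂ s) (h : ∀ t ∈ s, (z₁ t).1 = (z₂ t).1) : EqOn z₁ z₂ s := by
  intro t ht
  have h1 : HasDerivWithinAt (fun τ => (z₁ τ).1) (z₁ t).2 s t := (hz₁ t ht).fst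
  have h2 : HasDerivWithinAt (fun τ => (z₂ τ).1) (z₂ t).2 s t := (hz₂ t ht).fst
  refine Prod.ext (h t ht) ?_
  rw [← h1.derivWithin (hs t ht), ← h2.derivWithin (hs t ht)]
  exact derivWithin_congr h (h t ht)

/-- Local forward uniqueness of causal geodesics. -/
theorem exists_eqOn_of_eq_zero (hnb : g.CausallyNonBranching) (hni : g.NonIntertwining)
    (hφ : φ ∈ atlas (EuclideanSpace ℝ (Fin n)) M)
    {z₁ z₂ : ℝ → EuclideanSpace ℝ (Fin n) × EuclideanSpace ℝ (Fin n)} {b : ℝ} (hb : 0 < b)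
    (hz₁ : IsSolutionOn (g.spray φ) z₁ (Icc 0 b)) (hz₂ : IsSolutionOn (g.spray φ) z₂ (Icc 0 b))
    (hm₁ : ∀ t ∈ Icc 0 b, (z₁ t).1 ∈ φ.target) (hm₂ : ∀ t ∈ Icc 0 b, (z₂ t).1 ∈ φ.target)
    (h0 : z₁ 0 = z₂ 0) (hc : g.form φ (z₁ 0).1 (z₁ 0).2 (z₁ 0).2 ≤ 0) :
    ∃ ε > 0, ε ≤ b ∧ EqOn z₁ z₂ (Icc 0 ε) := by
  by_cases hv : (z₁ 0).2 = 0
  · refine ⟨b, hb, le_rfl, fun t ht => ?_⟩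
    rw [eqOn_const_of_velocity_eq_zero hφ hz₁ hm₁ hv t ht,
      eqOn_const_of_velocity_eq_zero hφ hz₂ hm₂ (by rwa [← h0]) t ht, h0]
  have h0b : (0 : ℝ) ∈ Icc 0 b := left_mem_Icc.2 hb.le
  let q : M := φ.symm (z₁ 0).1
  let γ₁ : ℝ → M := fun τ => φ.symm (z₁ τ).1
  let γ₂ : ℝ → M := fun τ => φ.symm (z₂ τ).1
  have hle : 𝓝[>] (0 : ℝ) ≤ 𝓝[Icc 0 b] 0 := by
    refine nhdsWithin_le_of_mem ?_
    exact mem_of_superset (Ioc_mem_nhdsGT hb) Ioc_subset_Icc_self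
  have hγ : ∀ {z : ℝ → EuclideanSpace ℝ (Fin n) × EuclideanSpace ℝ (Fin n)},
      IsSolutionOn (g.spray φ) z (Icc 0 b) → (z 0).1 ∈ φ.target →
        Tendsto (fun τ => φ.symm (z τ).1) (𝓝[>] 0) (𝓝 (φ.symm (z 0).1)) := fun hz hm =>
    (φ.symm.continuousAt hm).tendsto.comp
      ((hz.continuousOn.fst 0 h0b).tendsto.mono_left hle)
  have hγ₁ : Tendsto γ₁ (𝓝[>] 0) (𝓝 q) := hγ hz₁ (hm₁ 0 h0b)
  have hγ₂ : Tendsto γ₂ (𝓝[>] 0) (𝓝 q) := by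
    have := hγ hz₂ (hm₂ 0 h0b)
    rwa [← h0] at this
  -- Nonzero initial velocity makes the curve leave `q`. Accumulation points ignore the point
  -- itself, so this is needed below.
  have hne : ∀ᶠ t in 𝓝[>] (0 : ℝ), γ₁ t ≠ q := by
    have h1 : HasDerivWithinAt (fun τ => (z₁ τ).1) (z₁ 0).2 (Icc 0 b) 0 := (hz₁ 0 h0b).fst
    have h2 := h1.eventually_ne (c := (z₁ 0).1) hv
    have hle' : 𝓝[>] (0 : ℝ) ≤ 𝓝[Icc 0 b \ {0}] 0 := by
      refine nhdsWithin_le_of_mem (mem_of_superset (Ioc_mem_nhdsGT hb) fun t ht => ?_)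
      exact ⟨⟨ht.1.le, ht.2⟩, ht.1.ne'⟩
    filter_upwards [hle' h2, Ioc_mem_nhdsGT hb] with t ht htb heq
    exact ht (φ.symm.injOn (hm₁ t ⟨htb.1.le, htb.2⟩) (hm₁ 0 h0b) heq)
  obtain ⟨U, hU, hUni⟩ := hni q
  obtain ⟨ε, hε, hεs⟩ := mem_nhdsGT_iff_exists_Ioc_subset.1
    ((hγ₁.eventually hU).and ((hγ₂.eventually hU).and (Ioc_mem_nhdsGT hb)))
  have hε0 : (0 : ℝ) < ε := hε
  have hεb : ε ≤ b := (hεs (right_mem_Ioc.2 hε0)).2.2.2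
  have hsub : Icc 0 ε ⊆ Icc 0 b := Icc_subset_Icc_right hεb
  have huniq : UniqueDiffOn ℝ (Icc 0 ε) := uniqueDiffOn_Icc hε0
  have hmaps : ∀ i : ℝ → M, i 0 = q → (∀ t ∈ Ioc 0 ε, i t ∈ U) → MapsTo i (Icc 0 ε) U := by
    intro i hi0 hi t ht
    rcases ht.1.eq_or_lt with rfl | h
    · rw [hi0]; exact mem_of_mem_nhds hU
    · exact hi t ⟨h, ht.2⟩
  have hcaus : ∀ {z : ℝ → EuclideanSpace ℝ (Fin n) × EuclideanSpace ℝ (Fin n)},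
      IsSolutionOn (g.spray φ) z (Icc 0 b) → (∀ t ∈ Icc 0 b, (z t).1 ∈ φ.target) →
      z 0 = z₁ 0 → g.IsCausalGeodesicOn (fun τ => φ.symm (z τ).1) (Icc 0 ε) := by
    intro z hz hm hz0
    refine isCausalGeodesicOn_symm_comp hφ (hz.mono hsub) huniq (fun t ht => hm t (hsub ht)) ?_
    intro t ht
    rw [g.energy_eq hφ hz hm (hsub ht) h0b, hz0]
    exact hc
  have hq₂ : γ₂ 0 = q := by simp only [γ₂, q, h0]
  rcases hUni ε hε0 γ₁ γ₂ (hcaus hz₁ hm₁ rfl) (hcaus hz₂ hm₂ h0.symm)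
    (hmaps γ₁ rfl fun t ht => (hεs ht).1) (hmaps γ₂ hq₂ fun t ht => (hεs ht).2.1) rfl hq₂ (by
      rw [curveVelocity_symm_comp hφ (hz₁.mono hsub) huniq (fun t ht => hm₁ t (hsub ht))
          (left_mem_Icc.2 hε0.le),
        curveVelocity_symm_comp hφ (hz₂.mono hsub) huniq (fun t ht => hm₂ t (hsub ht))
          (left_mem_Icc.2 hε0.le), h0]) with heq | hacc
  · refine ⟨ε, hε0, hεb, eqOn_of_eqOn_fst huniq (hz₁.mono hsub) (hz₂.mono hsub) fun t ht => ?_⟩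
    exact φ.symm.injOn (hm₁ t (hsub ht)) (hm₂ t (hsub ht)) (heq ht)
  · exfalso
    -- Since `q` is no accumulation point, a punctured neighborhood of `q` misses the common image.
    -- For times in `(0, ε']` the first curve lies there, so it avoids the second curve's image of
    -- `(0, ε]`.
    have hq := not_exists.1 hacc q
    rw [accPt_iff_frequently, not_frequently] at hq
    obtain ⟨ε', hε', hεs'⟩ := mem_nhdsGT_iff_exists_Ioc_subset.1
      ((hγ₁.eventually hq).and (hne.and (Ioc_mem_nhdsGT hε0)))
    have hε'0 : (0 : ℝ) < ε' := hε'
    have hε'ε : ε' ≤ ε := (hεs' (right_mem_Ioc.2 hε'0)).2.2.2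
    -- Branching requires a common past, so a Peano solution through the initial data is put in
    -- front of both curves.
    obtain ⟨r, hr, hrs⟩ := Metric.nhds_basis_closedBall.mem_iff.1
      ((φ.open_target.prod isOpen_univ).mem_nhds
        (show z₁ 0 ∈ φ.target ×ˢ (univ : Set (EuclideanSpace ℝ (Fin n))) from
          ⟨hm₁ 0 h0b, mem_univ _⟩))
    obtain ⟨δ, hδ, y, hy0, hy, hyr⟩ := exists_isSolutionOn_of_continuousOn hr
      ((g.continuousOn_spray hφ).mono hrs)
    have hy' : IsSolutionOn (g.spray φ) y (Icc (-δ) 0) := hy.mono (Icc_subset_Icc_right hδ.le)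
    have hδ0 : -δ ≤ 0 := by linarith
    let Z : (ℝ → EuclideanSpace ℝ (Fin n) × EuclideanSpace ℝ (Fin n)) → ℝ →
      EuclideanSpace ℝ (Fin n) × EuclideanSpace ℝ (Fin n) := fun z τ => if τ ≤ 0 then y τ else z τ
    have hZpos : ∀ z τ, 0 < τ → Z z τ = z τ := fun z τ hτ => if_neg (not_le.2 hτ)
    have hZneg : ∀ z τ, τ ≤ 0 → Z z τ = y τ := fun z τ hτ => if_pos hτ
    have hZ₁ : IsSolutionOn (g.spray φ) (Z z₁) (Icc (-δ) b) := hy'.glue hδ0 hb.le hz₁ hy0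
    have hZ₂ : IsSolutionOn (g.spray φ) (Z z₂) (Icc (-δ) b) :=
      hy'.glue hδ0 hb.le hz₂ (hy0.trans h0)
    have hZm : ∀ {z : ℝ → EuclideanSpace ℝ (Fin n) × EuclideanSpace ℝ (Fin n)},
        (∀ t ∈ Icc 0 b, (z t).1 ∈ φ.target) → ∀ t ∈ Icc (-δ) b, (Z z t).1 ∈ φ.target := by
      intro z hm t ht
      rcases le_or_gt t 0 with h | h
      · rw [hZneg z t h]
        exact (hrs (hyr t ⟨ht.1, h.trans hδ.le⟩)).1
      · rw [hZpos z t h]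
        exact hm t ⟨h.le, ht.2⟩
    -- The past exists for time `δ`, and disjointness holds up to `ε'`; the minimum gives an
    -- interval symmetric about the branching time `0`.
    let η := min ε' δ
    have hη : 0 < η := lt_min hε'0 hδ
    have hηb : η ≤ b := (min_le_left _ _).trans (hε'ε.trans hεb)
    have hηδ : -δ ≤ -η := neg_le_neg (min_le_right _ _)
    have hIcc : Icc (-η) η ⊆ Icc (-δ) b := Icc_subset_Icc hηδ hηb
    refine hnb (-η) η (fun τ => φ.symm (Z z₁ τ).1) ?_ 0 ⟨by linarith, hη⟩
      ⟨η, hη, by linarith, by linarith, fun τ => φ.symm (Z z₂ τ).1, ?_, ?_, ?_⟩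
    · refine isCausalGeodesicOn_symm_comp hφ (hZ₁.mono hIcc)
        (uniqueDiffOn_Icc (by linarith)) (fun t ht => hZm hm₁ t (hIcc ht)) fun t ht => ?_
      rw [g.energy_eq hφ hZ₁ (hZm hm₁) (hIcc ht) (hIcc (mem_Icc.2 ⟨neg_nonpos.2 hη.le, hη.le⟩)),
        hZneg z₁ 0 le_rfl, hy0]
      exact hc
    · have hIoo : Ioo (0 - η) (0 + η) ⊆ Icc (-δ) b := by
        rw [zero_sub, zero_add]
        exact Ioo_subset_Icc_self.trans hIcc
      exact isGeodesicOn_symm_comp hφ (hZ₂.mono hIoo) isOpen_Ioo.uniqueDiffOn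
        fun t ht => hZm hm₂ t (hIoo ht)
    · intro t ht
      simp only [hZneg _ t ht.2]
    · rw [Set.disjoint_left]
      rintro _ ⟨s, hs, rfl⟩ ⟨t, ht, hst⟩
      rw [zero_add] at hs ht
      simp only [hZpos _ s hs.1, hZpos _ t ht.1] at hst
      have hs' : s ∈ Ioc 0 ε' := ⟨hs.1, hs.2.le.trans (min_le_left _ _)⟩
      have ht' : t ∈ Ioc 0 ε := ⟨ht.1, ht.2.le.trans ((min_le_left _ _).trans hε'ε)⟩
      obtain ⟨ha, hb', hc'⟩ := hεs' hs'
      exact ha ⟨hb', ⟨s, hc', rfl⟩, ⟨t, ht', hst⟩⟩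

/-- Forward uniqueness of causal geodesics in a chart. -/
theorem eqOn_of_eq_left (hnb : g.CausallyNonBranching) (hni : g.NonIntertwining)
    (hφ : φ ∈ atlas (EuclideanSpace ℝ (Fin n)) M)
    {z₁ z₂ : ℝ → EuclideanSpace ℝ (Fin n) × EuclideanSpace ℝ (Fin n)} {a b : ℝ}
    (hz₁ : IsSolutionOn (g.spray φ) z₁ (Icc a b)) (hz₂ : IsSolutionOn (g.spray φ) z₂ (Icc a b))
    (hm₁ : ∀ t ∈ Icc a b, (z₁ t).1 ∈ φ.target) (hm₂ : ∀ t ∈ Icc a b, (z₂ t).1 ∈ φ.target)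
    (ha : z₁ a = z₂ a) (hc : g.form φ (z₁ a).1 (z₁ a).2 (z₁ a).2 ≤ 0) :
    EqOn z₁ z₂ (Icc a b) := by
  rcases lt_or_ge b a with hab | hab
  · rw [Icc_eq_empty (not_le.2 hab)]; exact eqOn_empty _ _
  have hcl : IsClosed ({t | z₁ t = z₂ t} ∩ Icc a b) := by
    have := (hz₁.continuousOn.sub hz₂.continuousOn).preimage_isClosed_of_isClosed isClosed_Icc
      (isClosed_singleton (x := (0 : EuclideanSpace ℝ (Fin n) × EuclideanSpace ℝ (Fin n))))
    convert this using 1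
    ext t
    simp [sub_eq_zero, and_comm]
  refine hcl.Icc_subset_of_forall_exists_gt ha ?_
  rintro x ⟨hx, hxab⟩ y hy
  have hx' : x ∈ Icc a b := ⟨hxab.1, hxab.2.le⟩
  have hsub : ∀ t ∈ Icc 0 (b - x), t + x ∈ Icc a b := fun t ht =>
    ⟨by linarith [ht.1, hxab.1], by linarith [ht.2]⟩
  -- The equation is autonomous, so time `x` may be shifted to `0`; constancy of the energy carries
  -- causality from `a` to `x`.
  obtain ⟨ε, hε, hεb, heq⟩ := exists_eqOn_of_eq_zero hnb hni hφ (sub_pos.2 hxab.2)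
    ((hz₁.comp_add_const x).mono hsub) ((hz₂.comp_add_const x).mono hsub)
    (fun t ht => hm₁ _ (hsub t ht)) (fun t ht => hm₂ _ (hsub t ht)) (by simpa using hx) (by
      simp only [zero_add]
      rw [g.energy_eq hφ hz₁ hm₁ hx' (left_mem_Icc.2 hab)]
      exact hc)
  have hy' : 0 < y - x := sub_pos.2 hy
  refine ⟨min ε (y - x) + x, ?_, ?_, ?_⟩
  · exact heq ⟨(lt_min hε hy').le, min_le_left _ _⟩
  · linarith [lt_min hε hy']
  · linarith [min_le_right ε (y - x)]

end C1LorentzMetric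

/-! ### Continuous dependence and the exponential map -/

namespace C1LorentzMetric

variable {n : ℕ} {M : Type*} [TopologicalSpace M]
  [ChartedSpace (EuclideanSpace ℝ (Fin n)) M] [IsManifold (𝓡 n) ∞ M]
  {g : C1LorentzMetric n M} {φ ψ : OpenPartialHomeomorph M (EuclideanSpace ℝ (Fin n))}

theorem uniqueDiffOn_of_ordConnected {J : Set ℝ} (hJ : J.OrdConnected) (h01 : Icc 0 1 ⊆ J) :
    UniqueDiffOn ℝ J := by
  refine uniqueDiffOn_convex hJ.convex (Nonempty.mono (interior_mono h01) ?_)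
  rw [interior_Icc]
  exact nonempty_Ioo.2 zero_lt_one

/-- A geodesic that starts in a ball of the tangent bundle of a chart stays in a larger ball for a
time controlled by the size of the spray. -/
theorem chartLift_mem_closedBall [T2Space M] {γ : ℝ → M} {J : Set ℝ} (h : g.IsGeodesicOn γ J)
    (hJ : UniqueDiffOn ℝ J) (hφ : φ ∈ atlas (EuclideanSpace ℝ (Fin n)) M)
    {w : EuclideanSpace ℝ (Fin n) × EuclideanSpace ℝ (Fin n)} {r R L a b : ℝ} (hL0 : 0 ≤ L)
    (hR : Metric.closedBall w R ⊆ φ.target ×ˢ univ)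
    (hL : ∀ x ∈ Metric.closedBall w R, ‖g.spray φ x‖ ≤ L) (hab : a ≤ b) (hsub : Icc a b ⊆ J)
    (ha : γ a ∈ φ.source) (hw : dist (chartLift φ γ J a) w ≤ r) (hr : r + L * (b - a) < R) :
    ∀ t ∈ Icc a b, γ t ∈ φ.source ∧ chartLift φ γ J t ∈ Metric.closedBall w R := by
  let S : Set ℝ := {t | γ t ∈ φ.source ∧ chartLift φ γ J t ∈ Metric.closedBall w R}
  have hγ : ContinuousOn γ (Icc a b) := h.1.continuousOn.mono hsub
  have hsrc : ∀ t ∈ Icc a b, γ t ∈ φ.source → ∀ᶠ τ in 𝓝[Icc a b] t, γ τ ∈ φ.source :=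
    fun t ht hts => (hγ t ht).eventually (φ.open_source.eventually_mem hts)
  have hlift : ∀ t ∈ Icc a b, γ t ∈ φ.source →
      ContinuousWithinAt (chartLift φ γ J) (Icc a b) t := by
    intro t ht hts
    have hsol := h.isSolutionOn_chartLift hJ (s := Icc a b ∩ γ ⁻¹' φ.source)
      (inter_subset_left.trans hsub) hφ fun τ hτ => hτ.2
    exact (hsol.continuousOn t ⟨ht, hts⟩).mono_of_mem_nhdsWithin
      (inter_mem self_mem_nhdsWithin (hsrc t ht hts))
  have hSclosed : ∀ t ∈ Icc a b, (∃ᶠ τ in 𝓝[Icc a b] t, τ ∈ S) → t ∈ S := by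
    intro t ht hfr
    -- The chart source is open, so a limit of times in `S` could leave it. This compact subset of
    -- the source is closed because `M` is Hausdorff, and it traps the limit point.
    have hK : IsCompact (φ.symm '' (Prod.fst '' Metric.closedBall w R)) := by
      refine ((isCompact_closedBall w R).image continuous_fst).image_of_continuousOn
        (φ.symm.continuousOn.mono ?_)
      rintro _ ⟨x, hx, rfl⟩
      exact (hR hx).1
    have hmem : γ t ∈ φ.symm '' (Prod.fst '' Metric.closedBall w R) := by
      refine hK.isClosed.mem_of_frequently_of_tendsto ?_ (hγ t ht)
      refine hfr.mono fun τ hτ => ?_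
      exact ⟨φ (γ τ), ⟨_, hτ.2, rfl⟩, φ.left_inv hτ.1⟩
    have hts : γ t ∈ φ.source := by
      obtain ⟨_, ⟨x, hx, rfl⟩, hxt⟩ := hmem
      rw [← hxt]
      exact φ.map_target (hR hx).1
    refine ⟨hts, Metric.isClosed_closedBall.mem_of_frequently_of_tendsto ?_ (hlift t ht hts)⟩
    exact hfr.mono fun τ hτ => hτ.2
  have haS : a ∈ S := ⟨ha, Metric.mem_closedBall.2 (hw.trans (by
    have := mul_nonneg hL0 (sub_nonneg.2 hab)
    linarith))⟩
  have hmain : Icc a b ⊆ {t | ∀ τ ∈ Icc a t, τ ∈ S} := by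
    refine IsClosed.Icc_subset_of_forall_exists_gt ?_ ?_ ?_
    · refine isClosed_of_closure_subset fun t ht => ?_
      have htab : t ∈ Icc a b := closure_minimal inter_subset_right isClosed_Icc ht
      refine ⟨fun τ hτ => ?_, htab⟩
      rcases hτ.2.eq_or_lt with rfl | hlt
      · refine hSclosed τ htab ?_
        have := mem_closure_iff_frequently.1 ht
        rw [frequently_nhdsWithin_iff]
        exact this.mono fun x hx => ⟨hx.1 x ⟨hx.2.1, le_rfl⟩, hx.2⟩
      · obtain ⟨x, hx, hx'⟩ := ((mem_closure_iff_frequently.1 ht).and_eventually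
          (Ioi_mem_nhds hlt)).exists
        exact hx.1 τ ⟨hτ.1, le_of_lt hx'⟩
    · intro τ hτ
      rw [le_antisymm hτ.2 hτ.1]
      exact haS
    · rintro x ⟨hx, hxab⟩ y hy
      have hxab' : x ∈ Icc a b := ⟨hxab.1, hxab.2.le⟩
      have hxs : γ x ∈ φ.source := (hx x ⟨hxab.1, le_rfl⟩).1
      have hsol := h.isSolutionOn_chartLift hJ (s := Icc a x)
        ((Icc_subset_Icc_right hxab.2.le).trans hsub) hφ fun τ hτ => (hx τ hτ).1
      -- The strict inequality puts the lift in the open ball, so it stays in the closed ball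
      -- slightly longer.
      have hbd : dist (chartLift φ γ J x) w < R := by
        have h1 := hsol.norm_sub_le (fun t ht => hL _ (hx t ht).2) (left_mem_Icc.2 hxab.1)
          (right_mem_Icc.2 hxab.1)
        rw [← dist_eq_norm, abs_of_nonneg (sub_nonneg.2 hxab.1)] at h1
        have h2 : L * (x - a) ≤ L * (b - a) :=
          mul_le_mul_of_nonneg_left (by linarith [hxab.2]) hL0
        linarith [dist_triangle (chartLift φ γ J x) (chartLift φ γ J a) w]
      have hev : ∀ᶠ τ in 𝓝[>] x, τ ∈ S := by
        have hle : 𝓝[>] x ≤ 𝓝[Icc a b] x := by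
          refine nhdsWithin_le_of_mem (mem_of_superset (Ioc_mem_nhdsGT hxab.2) ?_)
          exact fun τ hτ => ⟨hxab.1.trans hτ.1.le, hτ.2⟩
        refine hle ?_
        filter_upwards [hsrc x hxab' hxs, (hlift x hxab' hxs).eventually
          (Metric.isOpen_ball.mem_nhds (Metric.mem_ball.2 hbd))] with τ h1 h2
        exact ⟨h1, Metric.ball_subset_closedBall h2⟩
      obtain ⟨u, hu, hus⟩ := mem_nhdsGT_iff_exists_Ioc_subset.1 hev
      refine ⟨min u y, fun τ hτ => ?_, lt_min hu hy, min_le_right _ _⟩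
      rcases le_or_gt τ x with hτx | hτx
      · exact hx τ ⟨hτ.1, hτx⟩
      · exact hus ⟨hτx, hτ.2.trans (min_le_left _ _)⟩
  exact fun t ht => hmain ht t ⟨ht.1, le_rfl⟩

/-- The convergence at time `t` of the velocities of a sequence of curves. -/
def TendstoAt (γ : ℕ → ℝ → M) (J : ℕ → Set ℝ) (γ' : ℝ → M) (J' : Set ℝ) (t : ℝ) : Prop :=
  Tendsto (fun k => γ k t) atTop (𝓝 (γ' t)) ∧
    ∀ φ ∈ atlas (EuclideanSpace ℝ (Fin n)) M, γ' t ∈ φ.source →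
      Tendsto (fun k => chartLift φ (γ k) (J k) t) atTop (𝓝 (chartLift φ γ' J' t))

/-- Velocities change by the derivative of the transition map, which depends continuously on the
point, so one chart suffices. Demanding every chart in `TendstoAt` lets the induction along `[0, 1]`
change charts freely. -/
theorem tendstoAt_of_chart {γ : ℕ → ℝ → M} {J : ℕ → Set ℝ} {γ' : ℝ → M} {J' : Set ℝ} {t : ℝ}
    (hγ : ∀ k, MDifferentiableWithinAt 𝓘(ℝ, ℝ) (𝓡 n) (γ k) (J k) t)
    (hJ : ∀ k, UniqueDiffWithinAt ℝ (J k) t)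
    (hγ' : MDifferentiableWithinAt 𝓘(ℝ, ℝ) (𝓡 n) γ' J' t) (hJ' : UniqueDiffWithinAt ℝ J' t)
    (hlim : Tendsto (fun k => γ k t) atTop (𝓝 (γ' t)))
    (hφ : φ ∈ atlas (EuclideanSpace ℝ (Fin n)) M) (hs : γ' t ∈ φ.source)
    (hl : Tendsto (fun k => chartLift φ (γ k) (J k) t) atTop (𝓝 (chartLift φ γ' J' t))) :
    TendstoAt (n := n) γ J γ' J' t := by
  refine ⟨hlim, fun ψ hψ hs' => ?_⟩
  have h1 : Tendsto (fun k => ψ (γ k t)) atTop (𝓝 (ψ (γ' t))) :=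
    (ψ.continuousAt hs').tendsto.comp hlim
  refine h1.prodMk_nhds ?_
  rw [derivWithin_transition hφ hψ hγ' hJ' hs hs']
  have hev : ∀ᶠ k in atTop, fderiv ℝ (ψ ∘ φ.symm) (φ (γ k t)) (derivWithin (φ ∘ γ k) (J k) t) =
      derivWithin (ψ ∘ γ k) (J k) t := by
    filter_upwards [hlim.eventually (φ.open_source.eventually_mem hs),
      hlim.eventually (ψ.open_source.eventually_mem hs')] with k hk hk'
    exact (derivWithin_transition hφ hψ (hγ k) (hJ k) hk hk').symm
  refine Tendsto.congr' hev ?_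
  have hc : ContinuousAt (fderiv ℝ (ψ ∘ φ.symm)) (φ (γ' t)) :=
    ((contDiffAt_transition hφ hψ (φ.map_source hs)
      (by rwa [φ.left_inv hs])).fderiv_right (m := 1) (by norm_num)).continuousAt
  exact (isBoundedBilinearMap_apply.continuous.tendsto (_, _)).comp
    ((hc.tendsto.comp ((continuous_fst.tendsto _).comp hl)).prodMk_nhds
      ((continuous_snd.tendsto _).comp hl))

theorem chartLift_zero_of_curveVelocity (hφ : φ ∈ atlas (EuclideanSpace ℝ (Fin n)) M) {p : M}
    {v : TangentSpace (𝓡 n) p} {γ : ℝ → M} {J : Set ℝ} {t : ℝ}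
    (hγ : MDifferentiableWithinAt 𝓘(ℝ, ℝ) (𝓡 n) γ J t) (hJ : UniqueDiffWithinAt ℝ J t)
    (h : curveVelocity (n := n) γ J t = ⟨p, v⟩) (hp : p ∈ φ.source) :
    chartLift φ γ J t = (φ p, mfderiv (𝓡 n) (𝓡 n) φ p v) := by
  have h0 : γ t = p := congrArg (fun X : TangentBundle (𝓡 n) M => X.1) h
  have h1 := congrArg (fun X : TangentBundle (𝓡 n) M =>
    (mfderiv (𝓡 n) (𝓡 n) φ X.1 X.2 : EuclideanSpace ℝ (Fin n))) h
  have hs : γ t ∈ φ.source := by rwa [h0]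
  exact Prod.ext (congrArg φ h0) ((derivWithin_chart_comp hφ hγ hJ hs).trans h1)

/-- Near `t₀` one chart suffices. Compactness provides subsequential limits of the lifts that solve
the spray equation and agree with the lift of `γ'` at `t₁`; forward uniqueness makes them agree at
`t₂`. Only the limit curve has to be causal. -/
theorem exists_tendstoAt_of_le [T2Space M] (hnb : g.CausallyNonBranching) (hni : g.NonIntertwining)
    {γ : ℕ → ℝ → M} {J : ℕ → Set ℝ} {γ' : ℝ → M} {J' : Set ℝ}
    (hγ : ∀ k, g.IsGeodesicOn (γ k) (J k)) (hγ' : g.IsCausalGeodesicOn γ' J')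
    (hJ : ∀ k, UniqueDiffOn ℝ (J k)) (hJ' : UniqueDiffOn ℝ J') (hsub : ∀ k, Icc 0 1 ⊆ J k)
    (hsub' : Icc 0 1 ⊆ J') {t₀ : ℝ} (ht₀ : t₀ ∈ Icc (0 : ℝ) 1) :
    ∃ ρ > 0, ∀ t₁ ∈ Icc (0 : ℝ) 1, ∀ t₂ ∈ Icc (0 : ℝ) 1, |t₁ - t₀| < ρ → |t₂ - t₀| < ρ →
      t₁ ≤ t₂ → TendstoAt (n := n) γ J γ' J' t₁ → TendstoAt (n := n) γ J γ' J' t₂ := by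
  let φ : OpenPartialHomeomorph M (EuclideanSpace ℝ (Fin n)) := chartAt _ (γ' t₀)
  have hφ : φ ∈ atlas (EuclideanSpace ℝ (Fin n)) M := chart_mem_atlas _ _
  have hs₀ : γ' t₀ ∈ φ.source := mem_chart_source _ _
  let z : ℝ → EuclideanSpace ℝ (Fin n) × EuclideanSpace ℝ (Fin n) := chartLift φ γ' J'
  obtain ⟨R, hR, hRs⟩ := Metric.nhds_basis_closedBall.mem_iff.1
    ((φ.open_target.prod isOpen_univ).mem_nhds
      (show z t₀ ∈ φ.target ×ˢ (univ : Set (EuclideanSpace ℝ (Fin n))) from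
        ⟨φ.map_source hs₀, mem_univ _⟩))
  obtain ⟨L, hL⟩ := (isCompact_closedBall (z t₀) R).exists_bound_of_continuousOn
    ((g.continuousOn_spray hφ).mono hRs)
  have hL0 : 0 ≤ L := (norm_nonneg _).trans (hL _ (Metric.mem_closedBall_self hR.le))
  have hcont : ContinuousOn γ' (Icc 0 1) := hγ'.1.1.continuousOn.mono hsub'
  have hsrc : ∀ᶠ t in 𝓝[Icc 0 1] t₀, γ' t ∈ φ.source :=
    (hcont t₀ ht₀).eventually (φ.open_source.eventually_mem hs₀)
  have hsol := hγ'.1.isSolutionOn_chartLift hJ' (s := Icc 0 1 ∩ γ' ⁻¹' φ.source)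
    (inter_subset_left.trans hsub') hφ fun τ hτ => hτ.2
  have hzc : ContinuousWithinAt z (Icc 0 1) t₀ :=
    (hsol.continuousOn t₀ ⟨ht₀, hs₀⟩).mono_of_mem_nhdsWithin (inter_mem self_mem_nhdsWithin hsrc)
  obtain ⟨ρ₀, hρ₀, hρ₀s⟩ := Metric.mem_nhdsWithin_iff.1 (hsrc.and (hzc.eventually
    (Metric.ball_mem_nhds (z t₀) (show 0 < R / 3 by positivity))))
  have hnear : ∀ t ∈ Icc (0 : ℝ) 1, |t - t₀| < ρ₀ → γ' t ∈ φ.source ∧ dist (z t) (z t₀) < R / 3 :=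
    fun t ht htρ => hρ₀s ⟨by rwa [Metric.mem_ball, Real.dist_eq], ht⟩
  -- The radius `R` is split in three: the distance of `z t₁` from `z t₀`, that of the approximating
  -- lift from `z t₁`, and the drift, at most `L * (2 * ρ)`, on `[t₁, t₂]`.
  let ρ := min ρ₀ (R / (6 * (L + 1)))
  have hρ : 0 < ρ := lt_min hρ₀ (by positivity)
  have hLρ : L * (2 * ρ) < R / 3 := by
    have h1 : ρ * (6 * (L + 1)) ≤ R := (le_div_iff₀ (by positivity)).1 (min_le_right _ _)
    nlinarith
  refine ⟨ρ, hρ, fun t₁ ht₁ t₂ ht₂ h₁ h₂ h12 hP => ?_⟩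
  have hI : Icc t₁ t₂ ⊆ Icc 0 1 := Icc_subset_Icc ht₁.1 ht₂.2
  have hIρ : ∀ t ∈ Icc t₁ t₂, |t - t₀| < ρ₀ := fun t ht => by
    refine lt_of_lt_of_le ?_ (min_le_left _ _ : ρ ≤ ρ₀)
    rw [abs_lt] at h₁ h₂ ⊢
    constructor <;> linarith [ht.1, ht.2]
  have hlen : L * (t₂ - t₁) ≤ L * (2 * ρ) := by
    refine mul_le_mul_of_nonneg_left ?_ hL0
    rw [abs_lt] at h₁ h₂
    linarith
  have hs₁ := hnear t₁ ht₁ (hIρ t₁ (left_mem_Icc.2 h12))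
  have hs₂ := hnear t₂ ht₂ (hIρ t₂ (right_mem_Icc.2 h12))
  have hz : IsSolutionOn (g.spray φ) z (Icc t₁ t₂) :=
    hsol.mono fun t ht => ⟨hI ht, (hnear t (hI ht) (hIρ t ht)).1⟩
  have hzm : ∀ t ∈ Icc t₁ t₂, (z t).1 ∈ φ.target := fun t ht =>
    φ.map_source (hnear t (hI ht) (hIρ t ht)).1
  have hcaus : g.form φ (z t₁).1 (z t₁).2 (z t₁).2 ≤ 0 := by
    rw [← g.val_curveVelocity hφ (hγ'.1.mdifferentiableWithinAt (hsub' ht₁)) (hJ' t₁ (hsub' ht₁))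
      hs₁.1]
    exact hγ'.2 t₁ (hsub' ht₁)
  let zk : ℕ → ℝ → EuclideanSpace ℝ (Fin n) × EuclideanSpace ℝ (Fin n) :=
    fun k => chartLift φ (γ k) (J k)
  have hlim₁ : Tendsto (fun k => zk k t₁) atTop (𝓝 (z t₁)) := hP.2 φ hφ hs₁.1
  have hstay : ∀ᶠ k in atTop, ∀ t ∈ Icc t₁ t₂,
      γ k t ∈ φ.source ∧ zk k t ∈ Metric.closedBall (z t₀) R := by
    filter_upwards [hP.1.eventually (φ.open_source.eventually_mem hs₁.1),
      hlim₁.eventually (Metric.ball_mem_nhds _ (show 0 < R / 3 by positivity))] with k hk1 hk2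
    refine chartLift_mem_closedBall (r := R / 3 + R / 3) (hγ k) (hJ k) hφ hL0 hRs hL h12
      (hI.trans (hsub k)) hk1 ?_ (by linarith)
    exact (dist_triangle _ (z t₁) _).trans (add_le_add (Metric.mem_ball.1 hk2).le hs₁.2.le)
  have hlim₂ : Tendsto (fun k => zk k t₂) atTop (𝓝 (z t₂)) := by
    refine tendsto_of_subseq_tendsto fun ns hns => ?_
    -- The lifts stay in the ball only eventually, whereas the compactness theorem wants every term
    -- there; hence the shift by `N`.
    obtain ⟨N, hN⟩ := eventually_atTop.1 (hns.eventually hstay)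
    have hN' : ∀ j, ∀ t ∈ Icc t₁ t₂, γ (ns (j + N)) t ∈ φ.source ∧
        zk (ns (j + N)) t ∈ Metric.closedBall (z t₀) R := fun j => hN _ (Nat.le_add_left _ _)
    have hsolk : ∀ j, IsSolutionOn (g.spray φ) (zk (ns (j + N))) (Icc t₁ t₂) := fun j =>
      (hγ _).isSolutionOn_chartLift (hJ _) (hI.trans (hsub _)) hφ fun t ht => (hN' j t ht).1
    obtain ⟨χ, hχ, w, hwm, hw, hwl⟩ := exists_subseq_tendsto_isSolutionOn
      (isCompact_closedBall (z t₀) R) ((g.continuousOn_spray hφ).mono hRs)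
      (Fk := fun _ => g.spray φ) (L := L) (by
        rw [Metric.tendstoUniformlyOn_iff]
        intro ε hε
        simp [hε]) (fun _ => hL) h12 hsolk fun j t ht => (hN' j t ht).2
    have hns' : Tendsto (fun j => ns (χ j + N)) atTop atTop :=
      hns.comp ((tendsto_add_atTop_nat N).comp hχ.tendsto_atTop)
    have hw₁ : w t₁ = z t₁ :=
      tendsto_nhds_unique (hwl t₁ (left_mem_Icc.2 h12)) (hlim₁.comp hns')
    have hw₂ : z t₂ = w t₂ := eqOn_of_eq_left hnb hni hφ hz hw hzm (fun t ht => (hRs (hwm t ht)).1)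
      hw₁.symm hcaus (right_mem_Icc.2 h12)
    refine ⟨fun j => χ j + N, ?_⟩
    rw [hw₂]
    exact hwl t₂ (right_mem_Icc.2 h12)
  have ht₂' : t₂ ∈ Icc t₁ t₂ := right_mem_Icc.2 h12
  refine tendstoAt_of_chart (fun k => (hγ k).mdifferentiableWithinAt (hsub k ht₂))
    (fun k => hJ k t₂ (hsub k ht₂)) (hγ'.1.mdifferentiableWithinAt (hsub' ht₂))
    (hJ' t₂ (hsub' ht₂)) ?_ hφ hs₂.1 hlim₂
  have h3 : Tendsto (fun k => φ.symm (zk k t₂).1) atTop (𝓝 (φ.symm (z t₂).1)) :=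
    (φ.symm.continuousAt (hzm t₂ ht₂')).tendsto.comp ((continuous_fst.tendsto _).comp hlim₂)
  have h4 : φ.symm (z t₂).1 = γ' t₂ := φ.left_inv hs₂.1
  rw [h4] at h3
  refine h3.congr' ?_
  filter_upwards [hstay] with k hk
  exact φ.left_inv (hk t₂ ht₂').1

/-- Causal geodesics depend continuously on the initial velocity. -/
theorem tendsto_of_tendsto_velocity [T2Space M] (hnb : g.CausallyNonBranching)
    (hni : g.NonIntertwining) {p : M} {v : ℕ → TangentSpace (𝓡 n) p} {v' : TangentSpace (𝓡 n) p}
    {γ : ℕ → ℝ → M} {J : ℕ → Set ℝ} {γ' : ℝ → M} {J' : Set ℝ}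
    (hγ : ∀ k, g.IsCausalGeodesicFrom p (v k) (γ k) (J k))
    (hγ' : g.IsCausalGeodesicFrom p v' γ' J') (hv : Tendsto v atTop (𝓝 v'))
    {t : ℝ} (ht : t ∈ Icc (0 : ℝ) 1) : Tendsto (fun k => γ k t) atTop (𝓝 (γ' t)) := by
  have hJ : ∀ k, UniqueDiffOn ℝ (J k) := fun k =>
    uniqueDiffOn_of_ordConnected (hγ k).1 (hγ k).2.1
  have hJ' : UniqueDiffOn ℝ J' := uniqueDiffOn_of_ordConnected hγ'.1 hγ'.2.1
  have h0 : (0 : ℝ) ∈ Icc (0 : ℝ) 1 := by simp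
  refine (forall_mem_Icc_of_locally_propagates (P := TendstoAt (n := n) γ J γ' J') ?_
    (fun t₀ ht₀ => exists_tendstoAt_of_le hnb hni (fun k => (hγ k).2.2.1.1) hγ'.2.2.1 hJ hJ'
      (fun k => (hγ k).2.1) hγ'.2.1 ht₀) t ht).1
  have hp : ∀ {u : TangentSpace (𝓡 n) p} {c : ℝ → M} {I : Set ℝ},
      g.IsCausalGeodesicFrom p u c I → c 0 = p := fun h =>
    congrArg (fun X : TangentBundle (𝓡 n) M => X.1) h.2.2.2
  -- At time `0` the points all equal `p`, and the lifts converge because the differential of the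
  -- chart at `p` is continuous.
  constructor
  · simp only [hp (hγ _), hp hγ']
    exact tendsto_const_nhds
  · intro φ hφ hs
    rw [hp hγ'] at hs
    have hl : ∀ {u : TangentSpace (𝓡 n) p} {c : ℝ → M} {I : Set ℝ},
        g.IsCausalGeodesicFrom p u c I →
          chartLift φ c I 0 = (φ p, mfderiv (𝓡 n) (𝓡 n) φ p u) := fun h =>
      chartLift_zero_of_curveVelocity hφ (h.2.2.1.1.mdifferentiableWithinAt (h.2.1 h0))
        (uniqueDiffOn_of_ordConnected h.1 h.2.1 0 (h.2.1 h0)) h.2.2.2 hs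
    simp only [hl (hγ _), hl hγ']
    exact tendsto_const_nhds.prodMk_nhds
      (((mfderiv (𝓡 n) (𝓡 n) φ p).continuous.tendsto v').comp hv)

end C1LorentzMetric

theorem mainTheorem3 {n : ℕ} {M : Type*} [TopologicalSpace M] [T2Space M]
    [SecondCountableTopology M] [ChartedSpace (EuclideanSpace ℝ (Fin n)) M]
    [IsManifold (𝓡 n) ∞ M] (g : C1LorentzMetric n M)
    (hnb : g.CausallyNonBranching) (hni : g.NonIntertwining) (p : M) :
    (∀ (v : TangentSpace (𝓡 n) p) (γ₁ γ₂ : ℝ → M) (J₁ J₂ : Set ℝ),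
      g.IsCausalGeodesicFrom p v γ₁ J₁ → g.IsCausalGeodesicFrom p v γ₂ J₂ →
        Set.EqOn γ₁ γ₂ (Set.Icc 0 1)) ∧
    Continuous (g.causalExp p) := by
  refine ⟨fun v γ₁ γ₂ J₁ J₂ h₁ h₂ t ht => ?_, ?_⟩
  -- The constant sequence `γ₁` has converging initial velocities, so `γ₁ t` tends to both `γ₁ t`
  -- and `γ₂ t`; `M` is Hausdorff.
  · exact tendsto_nhds_unique tendsto_const_nhds
      (C1LorentzMetric.tendsto_of_tendsto_velocity hnb hni (v := fun _ => v) (fun _ => h₁) h₂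
        tendsto_const_nhds ht)
  · have : FirstCountableTopology (TangentSpace (𝓡 n) p) :=
      inferInstanceAs (FirstCountableTopology (EuclideanSpace ℝ (Fin n)))
    rw [continuous_iff_seqContinuous]
    intro v v' hv
    -- The geodesics used are exactly those chosen in `causalExp`; continuous dependence holds for
    -- any choice.
    choose J hJ using fun k => (v k).2.2.choose_spec
    obtain ⟨J', hJ'⟩ := v'.2.2.choose_spec
    exact C1LorentzMetric.tendsto_of_tendsto_velocity hnb hni hJ hJ'
      ((continuous_subtype_val.tendsto v').comp hv) (Set.right_mem_Icc.2 zero_le_one)
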